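/- **Setting.** Let $L>0$ and let $0<x_1^-<x_1^+<x_2^-<\dots<x_N^-<x_N^+<L$; put $D_i=(x_i^-,x_i^+)$, $\ell_i=x_i^+-x_i^-$, $D_i^m=D_i+mL$ for $m\in\mathbb Z$, and let the background be the complement of all closed resonators $\overline{D_i^m}$. Let $\rho_0,\kappa_0,\rho_{\mathrm r},\kappa_{\mathrm r}>0$, $\delta=\rho_{\mathrm r}/\rho_0<1$, $v_0=\sqrt{\kappa_0/\rho_0}$, $v_{\mathrm r}=\sqrt{\kappa_{\mathrm r}/\rho_{\mathrm r}}$. Let $s_i$ and $\kappa_i^p$ be nowhere vanishing real functions of $t$ with $$\frac1{s_i(t)}=\sum_{n=-M}^{M}s_{i,n}e^{\mathrm in\Omega t},\qquad \frac1{\kappa_i^p(t)}=\sum_{n=-M}^{M}k_{i,n}e^{\mathrm in\Omega t},\qquad \Omega>0,$$ and let $\frac1{\kappa_i(t)}=\frac1{\kappa_i^p(t)}+c_if(t)$, where $c_i\in\mathbb R$ and $f:\mathbb R\to\mathbb R$ is differentiable with $f(t)\to0$ as $|t|\to\infty$. A field $u(x,t)$ is a solution if it satisfies classically $\partial_t^2u-v_0^2\,\partial_x^2u=0$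 in the background, $\partial_t\big(\tfrac1{\kappa_i}\partial_tu\big)-v_{\mathrm r}^2\,\partial_x^2u=0$ in every $D_i^m$, and, at each end point of every $D_i^m$, $u|_{\mathrm{out}}=\tfrac1{s_i(t)}u|_{\mathrm{in}}$ and $\delta\,\partial_xu|_{\mathrm{out}}=\tfrac1{s_i(t)}\partial_xu|_{\mathrm{in}}$, where "out" and "in" denote the one-sided limits from the background and from the resonator. For $\alpha\in(-\pi/L,\pi/L]$ let $V_j^\alpha$ be the continuous function on $\mathbb R$ with $-(V_j^\alpha)''=0$ in the background, $V_j^\alpha=\delta_{ij}$ on $D_i$ and $V_j^\alpha(x+mL)=e^{\mathrm i\alpha mL}V_j^\alpha(x)$ for $m\in\mathbb Z$, and let $C_{ij}^\alpha=(V_j^\alpha)'|_-(x_i^-)-(V_j^\alpha)'|_+(x_i^+)$, where $|_\pm$ denotes the limit from the right, respectively the left. **Subwavelength regime.** Fix $0<\gamma<1$ and $K$. Assume $\Omega\le K\delta^{1/2}$, $M\le K\delta^{-\gamma/2}$, $\sum_n|s_{i,n}|\le K$, $\sum_n|k_{i,n}|\le K$, $|c_if(t)|\le K$ and $|c_if'(t)|\le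 K\delta^{(1-\gamma)/2}$ for all $i$ and $t$. Let $$u(x,t)=\int_{-\infty}^{\infty}v(x,\omega)\,e^{\mathrm i\omega t}\,\mathrm d\omega$$ be a solution, localised in time in the sense that it is such a Fourier integral (with $v$ jointly measurable), with $u(x+L,t)=e^{\mathrm i\alpha L}u(x,t)$, and with frequencies concentrated at the subwavelength scale $\delta^{(1-\gamma)/2}$: for some $A$, $$\int_{-\infty}^{\infty}\Big(1+\frac{\omega^2}{\delta^{1-\gamma}}\Big)|v(x,\omega)|\,\mathrm d\omega\le A<\infty\qquad\text{for all }x.$$ Let $v_i(\omega)=\ell_i^{-1}\int_{D_i}v(x,\omega)\,\mathrm dx$ and $u_i(t)=\int_{-\infty}^\infty v_i(\omega)e^{\mathrm i\omega t}\,\mathrm d\omega$. **Proposition.** There is a constant $C$, depending only on the geometry $(L,x_i^\pm)$, $v_0$, $v_{\mathrm r}$, $\gamma$ and $K$, such that in this situation, for every $i=1,\dots,N$: $v_i$ is integrable, $u_i$ and $\big(\tfrac1{\kappa_i^p}+c_if\big)u_i'$ are differentiable, $\big|\tfrac1{s_i(t)}(u(x,t)-u_i(t))\big|\le C\delta^{1-\gamma}A$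 for all $x\in D_i$ and $t\in\mathbb R$, and to leading order in $\delta$ $$\sum_{j=1}^N\frac1{s_j(t)}C_{ij}^\alpha u_j(t)=-\frac{\rho_{\mathrm r}\ell_i}{\delta\kappa_{\mathrm r}s_i(t)}\frac{\mathrm d}{\mathrm dt}\Big(\Big(\frac1{\kappa_i^p(t)}+c_if(t)\Big)\frac{\mathrm d}{\mathrm dt}u_i(t)\Big),$$ in the sense that for every $t\in\mathbb R$ the two sides differ by at most $C\delta^{1-\gamma}A$ in absolute value. -/

import Mathlib

open Filter Topology MeasureTheory

namespace TimeLocalisation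

/-- `N` resonators `(xl i, xr i)` inside the unit cell `(0, L)`, ordered from left to right. The
metamaterial is the array of all translates of the resonators by integer multiples of `L`. -/
structure Geometry (N : ℕ) where
  L : ℝ
  xl : Fin N → ℝ
  xr : Fin N → ℝ
  xl_pos : ∀ i, 0 < xl i
  xl_lt_xr : ∀ i, xl i < xr i
  xr_lt_L : ∀ i, xr i < L
  xr_lt_xl : ∀ i j, i < j → xr i < xl j

namespace Geometry

variable {N : ℕ} (g : Geometry N)

/-- The length of the `i`-th resonator. -/
def len (i : Fin N) : ℝ := g.xr i - g.xl i

/-- The left end point of the `i`-th resonator in the `m`-th cell. -/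
def left (i : Fin N) (m : ℤ) : ℝ := g.xl i + m * g.L

/-- The right end point of the `i`-th resonator in the `m`-th cell. -/
def right (i : Fin N) (m : ℤ) : ℝ := g.xr i + m * g.L

/-- The `i`-th resonator in the `m`-th cell. -/
def resonator (i : Fin N) (m : ℤ) : Set ℝ := Set.Ioo (g.left i m) (g.right i m)

/-- The background: all points outside the closed resonators of all cells. -/
def exterior : Set ℝ := {x | ∀ i m, x ∉ Set.Icc (g.left i m) (g.right i m)}

/-- The Brillouin zone `(-π/L, π/L]`. -/
def brillouinZone : Set ℝ := Set.Ioc (-(Real.pi / g.L)) (Real.pi / g.L)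

/-- The operator `f ↦ f'|₋(xl i) - f'|₊(xr i)`, with the one-sided limits of `f'` taken from
outside the `i`-th resonator of the central cell. -/
noncomputable def boundaryFlux (i : Fin N) (f : ℝ → ℂ) : ℂ :=
  limUnder (𝓝[<] (g.xl i)) (deriv f) - limUnder (𝓝[>] (g.xr i)) (deriv f)

/-- `V` is the `α`-quasiperiodic continuous function that is harmonic outside the resonators,
`1` on the `j`-th resonator and `0` on the other resonators of the central cell. -/
structure IsPotential (α : ℝ) (j : Fin N) (V : ℝ → ℂ) : Prop where
  continuous : Continuous V
  differentiableAt : ∀ x ∈ g.exterior, DifferentiableAt ℝ V x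
  differentiableAt_deriv : ∀ x ∈ g.exterior, DifferentiableAt ℝ (deriv V) x
  harmonic : ∀ x ∈ g.exterior, -deriv (deriv V) x = 0
  on_resonator : ∀ i, ∀ x ∈ g.resonator i 0, V x = if j = i then 1 else 0
  quasiperiodic : ∀ (x : ℝ) (m : ℤ),
    V (x + m * g.L) = Complex.exp (Complex.I * α * m * g.L) * V x

theorem L_pos (j : Fin N) : 0 < g.L := by
  linarith [g.xl_pos j, g.xl_lt_xr j, g.xr_lt_L j]

theorem trichotomy (i j : Fin N) (m : ℤ) (h : ¬ (i = j ∧ m = 0)) :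
    (m ≤ 0 ∧ g.right i m < g.xl j) ∨ (0 ≤ m ∧ g.xr j < g.left i m) := by
  have hL := g.L_pos j
  have h1 := g.xl_pos j
  have h2 := g.xr_lt_L j
  have h3 := g.xl_pos i
  have h4 := g.xr_lt_L i
  unfold left right
  rcases lt_trichotomy m 0 with hm | hm | hm
  · left
    have : (m : ℝ) ≤ -1 := by exact_mod_cast (by omega : m ≤ -1)
    exact ⟨hm.le, by nlinarith⟩
  · subst hm
    rcases lt_trichotomy i j with hij | hij | hij
    · left; exact ⟨le_rfl, by simpa using g.xr_lt_xl i j hij⟩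
    · exact absurd ⟨hij, rfl⟩ h
    · right; exact ⟨le_rfl, by simpa using g.xr_lt_xl j i hij⟩
  · right
    have : (1 : ℝ) ≤ m := by exact_mod_cast (by omega : 1 ≤ m)
    exact ⟨hm.le, by nlinarith⟩

/-- The end points of the two resonators next to the `j`-th one. -/
theorem exists_neighbours (j : Fin N) : ∃ a b : ℝ, a < g.xl j ∧ g.xr j < b ∧
    (∃ i m, a = g.right i m) ∧ (∃ i m, b = g.left i m) ∧
    ∀ i m, ¬ (i = j ∧ m = 0) → g.right i m ≤ a ∨ b ≤ g.left i m := by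
  classical
  have hL := g.L_pos j
  have h1 := g.xl_pos j
  have h2 := g.xr_lt_L j
  let S : Finset ℝ := ((Finset.univ ×ˢ Finset.Icc (-1 : ℤ) 0).image
    (fun p : Fin N × ℤ => g.right p.1 p.2)).filter (· < g.xl j)
  let T : Finset ℝ := ((Finset.univ ×ˢ Finset.Icc (0 : ℤ) 1).image
    (fun p : Fin N × ℤ => g.left p.1 p.2)).filter (g.xr j < ·)
  have memS : ∀ i m, -1 ≤ m → m ≤ 0 → g.right i m < g.xl j → g.right i m ∈ S := by
    intro i m hm hm' h
    exact Finset.mem_filter.2 ⟨Finset.mem_image.2 ⟨(i, m), by simp [hm, hm'], rfl⟩, h⟩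
  have memT : ∀ i m, 0 ≤ m → m ≤ 1 → g.xr j < g.left i m → g.left i m ∈ T := by
    intro i m hm hm' h
    exact Finset.mem_filter.2 ⟨Finset.mem_image.2 ⟨(i, m), by simp [hm, hm'], rfl⟩, h⟩
  have hr1 : ∀ i, g.right i (-1) < g.xl j := by
    intro i
    have := g.xr_lt_L i
    simp only [right]; push_cast; linarith
  have hl1 : ∀ i, g.xr j < g.left i 1 := by
    intro i
    have := g.xl_pos i
    simp only [left]; push_cast; linarith
  have hS : S.Nonempty := ⟨_, memS j (-1) le_rfl (by norm_num) (hr1 j)⟩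
  have hT : T.Nonempty := ⟨_, memT j 1 (by norm_num) le_rfl (hl1 j)⟩
  have hSm := Finset.mem_filter.1 (S.max'_mem hS)
  have hTm := Finset.mem_filter.1 (T.min'_mem hT)
  refine ⟨S.max' hS, T.min' hT, hSm.2, hTm.2, ?_, ?_, ?_⟩
  · obtain ⟨p, -, hp⟩ := Finset.mem_image.1 hSm.1
    exact ⟨p.1, p.2, hp.symm⟩
  · obtain ⟨p, -, hp⟩ := Finset.mem_image.1 hTm.1
    exact ⟨p.1, p.2, hp.symm⟩
  · intro i m him
    rcases g.trichotomy i j m him with ⟨hm, h⟩ | ⟨hm, h⟩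
    · left
      by_cases hm' : -1 ≤ m
      · exact S.le_max' _ (memS i m hm' hm h)
      · refine le_trans ?_ (S.le_max' _ (memS i (-1) le_rfl (by norm_num) (hr1 i)))
        have : (m : ℝ) ≤ -1 := by exact_mod_cast (by omega : m ≤ -1)
        simp only [right]; push_cast; nlinarith
    · right
      by_cases hm' : m ≤ 1
      · exact T.min'_le _ (memT i m hm hm' h)
      · refine le_trans (T.min'_le _ (memT i 1 (by norm_num) le_rfl (hl1 i))) ?_
        have : (1 : ℝ) ≤ m := by exact_mod_cast (by omega : 1 ≤ m)
        simp only [left]; push_cast; nlinarith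

/-- The trapezoidal function with support `[a, b]` and plateau `[c, d]`. -/
noncomputable def trapezoid (a c d b x : ℝ) : ℝ :=
  max 0 (min 1 (min ((x - a) / (c - a)) ((b - x) / (b - d))))

theorem trapezoid_outside {a c d b x : ℝ} (h1 : a < c) (h3 : d < b)
    (hx : x ≤ a ∨ b ≤ x) : trapezoid a c d b x = 0 := by
  unfold trapezoid
  apply max_eq_left
  rcases hx with hx | hx
  · exact (min_le_right _ _).trans ((min_le_left _ _).trans
      (div_nonpos_of_nonpos_of_nonneg (by linarith) (by linarith)))
  · exact (min_le_right _ _).trans ((min_le_right _ _).trans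
      (div_nonpos_of_nonpos_of_nonneg (by linarith) (by linarith)))

theorem trapezoid_plateau {a c d b x : ℝ} (h1 : a < c) (h3 : d < b)
    (hx : c ≤ x) (hx' : x ≤ d) : trapezoid a c d b x = 1 := by
  unfold trapezoid
  have e1 : 1 ≤ (x - a) / (c - a) := by rw [le_div_iff₀ (by linarith)]; linarith
  have e2 : 1 ≤ (b - x) / (b - d) := by rw [le_div_iff₀ (by linarith)]; linarith
  rw [min_eq_left (le_min e1 e2)]
  norm_num

theorem trapezoid_left {a c d b x : ℝ} (h1 : a < c) (h2 : c < d) (h3 : d < b)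
    (hx : a ≤ x) (hx' : x ≤ c) : trapezoid a c d b x = (x - a) / (c - a) := by
  unfold trapezoid
  have e1 : (x - a) / (c - a) ≤ 1 := by rw [div_le_one (by linarith)]; linarith
  have e2 : 1 ≤ (b - x) / (b - d) := by rw [le_div_iff₀ (by linarith)]; linarith
  rw [min_eq_left (e1.trans e2), min_eq_right e1, max_eq_right]
  exact div_nonneg (by linarith) (by linarith)

theorem trapezoid_right {a c d b x : ℝ} (h1 : a < c) (h2 : c < d) (h3 : d < b)
    (hx : d ≤ x) (hx' : x ≤ b) : trapezoid a c d b x = (b - x) / (b - d) := by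
  unfold trapezoid
  have e1 : 1 ≤ (x - a) / (c - a) := by rw [le_div_iff₀ (by linarith)]; linarith
  have e2 : (b - x) / (b - d) ≤ 1 := by rw [div_le_one (by linarith)]; linarith
  rw [min_eq_right (e2.trans e1), min_eq_right e2, max_eq_right]
  exact div_nonneg (by linarith) (by linarith)

/-- Off the plateau and the two outer corners the trapezoid is locally affine. -/
theorem trapezoid_affine {a c d b x : ℝ} (h1 : a < c) (h2 : c < d) (h3 : d < b)
    (ha : x ≠ a) (hb : x ≠ b) (hcd : x ∉ Set.Icc c d) :
    ∃ p q : ℝ, ∀ᶠ y in 𝓝 x, trapezoid a c d b y = p + q * y := by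
  by_cases hx1 : x < a
  · refine ⟨0, 0, ?_⟩
    filter_upwards [gt_mem_nhds hx1] with y hy
    rw [trapezoid_outside h1 h3 (Or.inl (le_of_lt hy))]; ring
  by_cases hx2 : x < c
  · have hx1' : a < x := lt_of_le_of_ne (not_lt.1 hx1) (Ne.symm ha)
    refine ⟨-a / (c - a), 1 / (c - a), ?_⟩
    filter_upwards [gt_mem_nhds hx2, lt_mem_nhds hx1'] with y hy hy'
    rw [trapezoid_left h1 h2 h3 (le_of_lt hy') (le_of_lt hy)]; ring
  have hx3 : d < x := by
    by_contra h
    exact hcd ⟨not_lt.1 hx2, not_lt.1 h⟩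
  by_cases hx4 : x < b
  · refine ⟨b / (b - d), -1 / (b - d), ?_⟩
    filter_upwards [gt_mem_nhds hx4, lt_mem_nhds hx3] with y hy hy'
    rw [trapezoid_right h1 h2 h3 (le_of_lt hy') (le_of_lt hy)]; ring
  · have hx4' : b < x := lt_of_le_of_ne (not_lt.1 hx4) (Ne.symm hb)
    refine ⟨0, 0, ?_⟩
    filter_upwards [lt_mem_nhds hx4'] with y hy
    rw [trapezoid_outside h1 h3 (Or.inr (le_of_lt hy))]; ring

theorem continuous_trapezoid (a c d b : ℝ) : Continuous (trapezoid a c d b) := by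
  unfold trapezoid
  fun_prop

/-- The potentials exist. -/
theorem exists_isPotential (α : ℝ) (j : Fin N) : ∃ V, g.IsPotential α j V := by
  obtain ⟨a, b, ha, hb, ⟨ia, ma, hia⟩, ⟨ib, mb, hib⟩, hnb⟩ := g.exists_neighbours j
  have hL := g.L_pos j
  have hj := g.xl_lt_xr j
  let φ : ℝ → ℝ := trapezoid a (g.xl j) (g.xr j) b
  let e : ℤ → ℂ := fun m => Complex.exp (Complex.I * α * m * g.L)
  let V : ℝ → ℂ := fun x => ∑' m : ℤ, e m * (φ (x - m * g.L) : ℂ)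
  have key : ∀ x : ℝ, ∃ S : Finset ℤ, ∀ᶠ y in 𝓝 x,
      V y = ∑ m ∈ S, e m * (φ (y - m * g.L) : ℂ) := by
    intro x
    refine ⟨Finset.Icc ⌊(x - 1 - b) / g.L⌋ ⌈(x + 1 - a) / g.L⌉, ?_⟩
    filter_upwards [gt_mem_nhds (show x < x + 1 by linarith),
      lt_mem_nhds (show x - 1 < x by linarith)] with y hy hy'
    refine tsum_eq_sum fun m hm => ?_
    have hφ : φ (y - m * g.L) = 0 := by
      apply trapezoid_outside ha hb
      by_contra hcon
      rw [not_or, not_le, not_le] at hcon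
      apply hm
      rw [Finset.mem_Icc]
      constructor
      · have : (x - 1 - b) / g.L ≤ m := by rw [div_le_iff₀ hL]; linarith [hcon.2]
        exact_mod_cast (Int.floor_le _).trans this
      · have : (m : ℝ) ≤ (x + 1 - a) / g.L := by rw [le_div_iff₀ hL]; linarith [hcon.1]
        exact_mod_cast this.trans (Int.le_ceil _)
    rw [hφ]; simp
  have affine : ∀ x ∈ g.exterior, ∃ p q : ℂ, ∀ᶠ y in 𝓝 x, V y = p + q * (y : ℂ) := by
    intro x hx
    obtain ⟨S, hS⟩ := key x
    have hloc : ∀ m : ℤ, ∃ p q : ℝ, ∀ᶠ y in 𝓝 x, φ (y - m * g.L) = p + q * y := by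
      intro m
      obtain ⟨p, q, hpq⟩ := trapezoid_affine (x := x - m * g.L) ha hj hb
        (fun h => hx ia (ma + m) (by
          have h5 := g.xl_lt_xr ia
          simp only [right] at hia
          simp only [left, right, Set.mem_Icc]; push_cast
          constructor <;> linarith))
        (fun h => hx ib (mb + m) (by
          have h5 := g.xl_lt_xr ib
          simp only [left] at hib
          simp only [left, right, Set.mem_Icc]; push_cast
          constructor <;> linarith))
        (fun h => hx j m (by
          simp only [left, right, Set.mem_Icc] at h ⊢
          constructor <;> linarith [h.1, h.2]))
      refine ⟨p - q * (m * g.L), q, ?_⟩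
      have hc : Tendsto (fun y : ℝ => y - m * g.L) (𝓝 x) (𝓝 (x - m * g.L)) :=
        (continuous_id.sub continuous_const).tendsto x
      filter_upwards [hc.eventually hpq] with y hy
      rw [show φ (y - m * g.L) = p + q * (y - m * g.L) from hy]; ring
    choose p q hpq using hloc
    refine ⟨∑ m ∈ S, e m * p m, ∑ m ∈ S, e m * q m, ?_⟩
    have hall : ∀ᶠ y in 𝓝 x, ∀ m ∈ S, φ (y - m * g.L) = p m + q m * y :=
      (Filter.eventually_all_finset S).2 fun m _ => hpq m
    filter_upwards [hS, hall] with y h1 h2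
    rw [h1, Finset.sum_mul, ← Finset.sum_add_distrib]
    refine Finset.sum_congr rfl fun m hm => ?_
    rw [h2 m hm]; push_cast; ring
  have hder : ∀ (p q : ℂ) (y : ℝ), HasDerivAt (fun y : ℝ => p + q * (y : ℂ)) q y := by
    intro p q y
    have := ((Complex.ofRealCLM.hasDerivAt (x := y)).const_mul q).const_add p
    simpa using this
  have hdV : ∀ x ∈ g.exterior, ∃ q : ℂ, DifferentiableAt ℝ V x ∧
      deriv V =ᶠ[𝓝 x] fun _ => q := by
    intro x hx
    obtain ⟨p, q, hpq⟩ := affine x hx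
    have hpq' : V =ᶠ[𝓝 x] fun y : ℝ => p + q * (y : ℂ) := hpq
    refine ⟨q, (hpq'.differentiableAt_iff).2 (hder p q x).differentiableAt, ?_⟩
    filter_upwards [hpq'.eventually_nhds] with y hy
    rw [Filter.EventuallyEq.deriv_eq hy, (hder p q y).deriv]
  refine ⟨V, ?_, ?_, ?_, ?_, ?_, ?_⟩
  · refine continuous_iff_continuousAt.2 fun x => ?_
    obtain ⟨S, hS⟩ := key x
    refine ContinuousAt.congr ?_ (Filter.EventuallyEq.symm hS)
    have hφ : Continuous φ := continuous_trapezoid _ _ _ _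
    exact Continuous.continuousAt (by fun_prop)
  · intro x hx
    obtain ⟨q, h1, -⟩ := hdV x hx
    exact h1
  · intro x hx
    obtain ⟨q, -, h2⟩ := hdV x hx
    exact (h2.differentiableAt_iff).2 (differentiableAt_const q)
  · intro x hx
    obtain ⟨q, -, h2⟩ := hdV x hx
    rw [h2.deriv_eq]; simp
  · intro i x hx
    simp only [resonator, left, right, Int.cast_zero, zero_mul, add_zero, Set.mem_Ioo] at hx
    have hz : ∀ m : ℤ, ¬ (i = j ∧ m = 0) → φ (x - m * g.L) = 0 := by
      intro m hm
      apply trapezoid_outside ha hb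
      rcases hnb i (-m) (by simpa using hm) with h | h
      · left; simp only [right] at h; push_cast at h; linarith
      · right; simp only [left] at h; push_cast at h; linarith
    by_cases hij : j = i
    · subst hij
      have h0 : φ x = 1 := trapezoid_plateau ha hb hx.1.le hx.2.le
      show (∑' m : ℤ, e m * (φ (x - m * g.L) : ℂ)) = _
      rw [tsum_eq_single 0]
      · simp [e, h0]
      · intro m hm
        rw [hz m (by simpa using hm)]; simp
    · show (∑' m : ℤ, e m * (φ (x - m * g.L) : ℂ)) = _
      rw [if_neg hij]
      convert tsum_zero with m
      rw [hz m (fun h => hij h.1.symm)]; simp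
  · intro x m
    show (∑' k : ℤ, e k * (φ (x + m * g.L - k * g.L) : ℂ)) =
      e m * ∑' k : ℤ, e k * (φ (x - k * g.L) : ℂ)
    rw [← tsum_mul_left, ← (Equiv.addRight m).tsum_eq]
    refine tsum_congr fun k => ?_
    simp only [Equiv.coe_addRight, e]
    rw [← mul_assoc, ← Complex.exp_add]
    congr 2
    · push_cast; ring_nf
    · congr 1; push_cast; ring_nf

/-- The potential `V_j^α`. -/
noncomputable def potential (α : ℝ) (j : Fin N) : ℝ → ℂ :=
  Classical.choose (g.exists_isPotential α j)

/-- The capacitance matrix `C^α`. -/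
noncomputable def capacitance (α : ℝ) : Matrix (Fin N) (Fin N) ℂ :=
  Matrix.of fun i j => g.boundaryFlux i (g.potential α j)

end Geometry

/-- The static bulk parameters of the background (`ρ₀`, `κ₀`) and of the resonators
(`ρr`, `κr`). -/
structure Bulk where
  ρ₀ : ℝ
  κ₀ : ℝ
  ρr : ℝ
  κr : ℝ
  ρ₀_pos : 0 < ρ₀
  κ₀_pos : 0 < κ₀
  ρr_pos : 0 < ρr
  κr_pos : 0 < κr

namespace Bulk

/-- The contrast parameter. -/
noncomputable def δ (b : Bulk) : ℝ := b.ρr / b.ρ₀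

/-- The wave speed in the background. -/
noncomputable def v₀ (b : Bulk) : ℝ := √(b.κ₀ / b.ρ₀)

/-- The wave speed in the resonators. -/
noncomputable def vr (b : Bulk) : ℝ := √(b.κr / b.ρr)

end Bulk

/-- The time modulation: boundary sources `s i` and periodic parts `κp i` whose reciprocals are
trigonometric polynomials of degree at most `M` and frequency `Ω`, with coefficients `σ i n` and
`k i n`, and the temporal defects `c i * f t`, with `f` decaying. -/
structure Modulation (N : ℕ) where
  Ω : ℝ
  M : ℕ
  s : Fin N → ℝ → ℝ
  κp : Fin N → ℝ → ℝ
  σ : Fin N → ℤ → ℂ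
  k : Fin N → ℤ → ℂ
  c : Fin N → ℝ
  f : ℝ → ℝ
  Ω_pos : 0 < Ω
  s_ne_zero : ∀ i t, s i t ≠ 0
  κp_ne_zero : ∀ i t, κp i t ≠ 0
  inv_s : ∀ i t, (((s i t)⁻¹ : ℝ) : ℂ) =
    ∑ n ∈ Finset.Icc (-(M : ℤ)) M, σ i n * Complex.exp (Complex.I * n * Ω * t)
  inv_κp : ∀ i t, (((κp i t)⁻¹ : ℝ) : ℂ) =
    ∑ n ∈ Finset.Icc (-(M : ℤ)) M, k i n * Complex.exp (Complex.I * n * Ω * t)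
  differentiable_f : Differentiable ℝ f
  tendsto_f : Tendsto f (cocompact ℝ) (𝓝 0)

namespace Modulation

variable {N : ℕ} (md : Modulation N)

/-- The reciprocal `1 / κ_i` of the defected modulation. -/
noncomputable def invκ (i : Fin N) (t : ℝ) : ℝ := (md.κp i t)⁻¹ + md.c i * md.f t

/-- The modulation is bounded and acts on subwavelength time scales, with constant `K`:
`Ω = O(δ^(1/2))`, `M = O(δ^(-γ/2))`, bounded coefficients, and a bounded defect whose time
derivative is of the order `δ^((1-γ)/2)` of the largest modulation frequency `M Ω`. -/
structure IsSubwavelength (δ γ K : ℝ) : Prop where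
  frequency : md.Ω ≤ K * δ ^ ((1 : ℝ) / 2)
  degree : (md.M : ℝ) ≤ K * δ ^ (-γ / 2)
  source : ∀ i, ∑ n ∈ Finset.Icc (-(md.M : ℤ)) md.M, ‖md.σ i n‖ ≤ K
  periodic : ∀ i, ∑ n ∈ Finset.Icc (-(md.M : ℤ)) md.M, ‖md.k i n‖ ≤ K
  defect : ∀ i t, |md.c i * md.f t| ≤ K
  defect_deriv : ∀ i t, |md.c i * deriv md.f t| ≤ K * δ ^ ((1 - γ) / 2)

end Modulation

/-- `A` and `B` are the limits of `w` along two filters, and they satisfy `p A = q B`. -/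
def Transmission (w : ℝ → ℂ) (outer inner : Filter ℝ) (p q : ℝ) : Prop :=
  ∃ A B : ℂ, Tendsto w outer (𝓝 A) ∧ Tendsto w inner (𝓝 B) ∧ p • A = q • B

/-- `u` is a classical solution of the time-modulated wave equation in the whole array: the wave
equation in the background, the modulated wave equation in the resonators, and the two transmission
conditions at both end points of every resonator, where the limits from the background stand on
the left. -/
structure IsSolution {N : ℕ} (g : Geometry N) (b : Bulk) (md : Modulation N)
    (u : ℝ → ℝ → ℂ) : Prop where
  exterior_time : ∀ x ∈ g.exterior, Differentiable ℝ (u x) ∧ Differentiable ℝ (deriv (u x))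
  exterior_space : ∀ x ∈ g.exterior, ∀ t, DifferentiableAt ℝ (fun y => u y t) x ∧
    DifferentiableAt ℝ (deriv fun y => u y t) x
  exterior_eq : ∀ x ∈ g.exterior, ∀ t,
    deriv (deriv (u x)) t - b.v₀ ^ 2 • deriv (deriv fun y => u y t) x = 0
  interior_time : ∀ i m, ∀ x ∈ g.resonator i m, Differentiable ℝ (u x) ∧
    Differentiable ℝ (fun t => md.invκ i t • deriv (u x) t)
  interior_space : ∀ i m, ∀ x ∈ g.resonator i m, ∀ t, DifferentiableAt ℝ (fun y => u y t) x ∧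
    DifferentiableAt ℝ (deriv fun y => u y t) x
  interior_eq : ∀ i m, ∀ x ∈ g.resonator i m, ∀ t,
    deriv (fun τ => md.invκ i τ • deriv (u x) τ) t
      - b.vr ^ 2 • deriv (deriv fun y => u y t) x = 0
  value_left : ∀ i m t, Transmission (fun y => u y t)
    (𝓝[<] (g.left i m)) (𝓝[>] (g.left i m)) 1 (md.s i t)⁻¹
  value_right : ∀ i m t, Transmission (fun y => u y t)
    (𝓝[>] (g.right i m)) (𝓝[<] (g.right i m)) 1 (md.s i t)⁻¹
  flux_left : ∀ i m t, Transmission (deriv fun y => u y t)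
    (𝓝[<] (g.left i m)) (𝓝[>] (g.left i m)) b.δ (md.s i t)⁻¹
  flux_right : ∀ i m t, Transmission (deriv fun y => u y t)
    (𝓝[>] (g.right i m)) (𝓝[<] (g.right i m)) b.δ (md.s i t)⁻¹

/-- The inverse Fourier transform in time. -/
noncomputable def invFourier (w : ℝ → ℂ) (t : ℝ) : ℂ :=
  ∫ ω : ℝ, w ω * Complex.exp (Complex.I * ω * t)

/-- The wave field `u(x, t)` with the Fourier amplitude `v(x, ω)`. -/
noncomputable def waveField (v : ℝ → ℝ → ℂ) (x t : ℝ) : ℂ := invFourier (v x) t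

/-- The Fourier amplitude `v` is integrable in the frequency and concentrated at frequencies of
order `η`: its moments up to order two at the scale `η` are at most `A`, uniformly in space. -/
structure IsLowFrequency (v : ℝ → ℝ → ℂ) (η A : ℝ) : Prop where
  measurable : AEStronglyMeasurable (Function.uncurry v) (volume.prod volume)
  integrable : ∀ x, Integrable fun ω => (1 + (ω / η) ^ 2) • v x ω
  moment : ∀ x, ∫ ω, ‖(1 + (ω / η) ^ 2) • v x ω‖ ≤ A

/-- The value `v_i(ω)` of the Fourier amplitude on the `i`-th resonator, that is, its mean. -/
noncomputable def resonatorAmplitude {N : ℕ} (g : Geometry N) (v : ℝ → ℝ → ℂ) (i : Fin N)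
    (ω : ℝ) : ℂ :=
  (g.len i)⁻¹ • ∫ x in Set.Ioo (g.xl i) (g.xr i), v x ω

/-- The time signal `u_i(t)` of the `i`-th resonator. -/
noncomputable def resonatorSignal {N : ℕ} (g : Geometry N) (v : ℝ → ℝ → ℂ) (i : Fin N) :
    ℝ → ℂ :=
  invFourier (resonatorAmplitude g v i)

end TimeLocalisation

/-! Freeze the time t and put η = δ^((1-γ)/2), so that η² = δ^(1-γ). The moment hypothesis bounds
the k-th time derivative of u by η^k A for k ≤ 2, and the modulation is bounded with time derivative
O(η). The two wave equations therefore give ∂ₓ²u = O(η² A) away from the interfaces: at each time u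
is nearly affine on every gap and on every resonator. `isQuasistatic_of_isSolution` records this,
and what follows it is mostly one-variable calculus in x.

On a gap, ∂ₓu is within O(η² A) of the slope between the end values, hence O(A). The flux condition
turns this into ∂ₓu / s_i = O(δ A) at the inner side of an interface, and δ ≤ η², so u / s_i is
constant on D_i up to O(η² A) (`norm_smul_sub_mean_le`). The weight 1 / s_i has to stay, as it has
no uniform lower bound. By the value condition the end values of a gap are then close to u_j / s_j
times the phase of the cell, and the exterior derivatives are close to the slopes of the
quasiperiodic interpolation of the numbers u_j / s_j (`norm_limit_sub_slope_le`). The potentials are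
affine on gaps, so the difference of the slopes on the two sides of D_i is exactly row i of the
capacitance matrix applied to u_j / s_j (`sum_capacitance`).

Averaging the interior equation over D_i loses nothing (`len_smul_deriv_modulated_eq`): multiplied
by ρr / (δ κr s_i), it gives exactly the jump of the exterior derivatives across D_i. Hence the
error of the proposition is the difference of two slope errors, one for each neighbouring gap. -/

namespace TimeLocalisation

/-! ### Time derivatives of Fourier integrals with weighted amplitude. -/

section Fourier

variable {η : ℝ} {w φ : ℝ → ℂ}

theorem weight_pos (η ω : ℝ) : 0 < 1 + (ω / η) ^ 2 := by positivity

/-- The quotient of `φ` by the weight is continuous and bounded by `c`, and it multiplies the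
integrable weighted amplitude. -/
theorem integrable_mul_of_weighted (hw : Integrable fun ω => (1 + (ω / η) ^ 2) • w ω)
    (hφ : Continuous φ) {c : ℝ} (hc : ∀ ω, ‖φ ω‖ ≤ c * (1 + (ω / η) ^ 2)) :
    Integrable fun ω => φ ω * w ω := by
  have hcont : Continuous fun ω : ℝ => (1 + (ω / η) ^ 2)⁻¹ • φ ω :=
    Continuous.smul (Continuous.inv₀ (by fun_prop) fun ω => (weight_pos η ω).ne') hφ
  have h := hw.bdd_mul (c := c) hcont.aestronglyMeasurable (ae_of_all _ fun ω => by
    have hp := weight_pos η ω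
    rw [norm_smul, Real.norm_of_nonneg (inv_nonneg.2 hp.le), inv_mul_le_iff₀ hp, mul_comm]
    exact hc ω)
  refine h.congr (ae_of_all _ fun ω => ?_)
  have hp := (weight_pos η ω).ne'
  simp only [smul_mul_smul_comm, inv_mul_cancel₀ hp, one_smul]

theorem norm_integral_mul_le_of_weighted (hw : Integrable fun ω => (1 + (ω / η) ^ 2) • w ω)
    {c : ℝ} (hc : ∀ ω, ‖φ ω‖ ≤ c * (1 + (ω / η) ^ 2)) :
    ‖∫ ω, φ ω * w ω‖ ≤ c * ∫ ω, ‖(1 + (ω / η) ^ 2) • w ω‖ := by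
  rw [← integral_const_mul]
  refine norm_integral_le_of_norm_le (hw.norm.const_mul c) (ae_of_all _ fun ω => ?_)
  rw [norm_mul, norm_smul, Real.norm_of_nonneg (weight_pos η ω).le, ← mul_assoc]
  exact mul_le_mul_of_nonneg_right (hc ω) (norm_nonneg _)

/-- The symbol of the `k`-th time derivative of the inverse Fourier transform. -/
noncomputable def timeSymbol (k : ℕ) (t ω : ℝ) : ℂ :=
  (Complex.I * ω) ^ k * Complex.exp (Complex.I * ω * t)

theorem continuous_timeSymbol (k : ℕ) (t : ℝ) : Continuous (timeSymbol k t) := by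
  unfold timeSymbol
  fun_prop

theorem norm_timeSymbol (k : ℕ) (t ω : ℝ) : ‖timeSymbol k t ω‖ = |ω| ^ k := by
  have : Complex.I * ω * t = ((ω * t : ℝ) : ℂ) * Complex.I := by push_cast; ring
  rw [timeSymbol, this, norm_mul, Complex.norm_exp_ofReal_mul_I]
  simp

/-- In the variable y = ω / η this is |y|^k ≤ 1 + y², which limits k to 2. Each time derivative
costs one factor η. -/
theorem norm_timeSymbol_le (hη : 0 < η) {k : ℕ} (hk : k ≤ 2) (t ω : ℝ) :
    ‖timeSymbol k t ω‖ ≤ η ^ k * (1 + (ω / η) ^ 2) := by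
  obtain ⟨y, rfl⟩ : ∃ y, ω = η * y := ⟨ω / η, by field_simp⟩
  rw [norm_timeSymbol, abs_mul, abs_of_pos hη, mul_pow, mul_div_cancel_left₀ _ hη.ne']
  gcongr
  have h := abs_nonneg y
  rw [← sq_abs y]
  interval_cases k
  · nlinarith
  · nlinarith
  · linarith

theorem hasDerivAt_timeSymbol (k : ℕ) (t ω : ℝ) :
    HasDerivAt (fun τ => timeSymbol k τ ω) (timeSymbol (k + 1) t ω) t := by
  have h1 : HasDerivAt (fun τ : ℝ => Complex.I * ω * (τ : ℂ)) (Complex.I * ω) t := by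
    simpa using (Complex.ofRealCLM.hasDerivAt (x := t)).const_mul (Complex.I * ω)
  have h2 := h1.cexp.const_mul ((Complex.I * ω) ^ k)
  refine h2.congr_deriv ?_
  unfold timeSymbol
  ring

/-- The `k`-th time derivative of the inverse Fourier transform. -/
noncomputable def timeMoment (w : ℝ → ℂ) (k : ℕ) (t : ℝ) : ℂ := ∫ ω, timeSymbol k t ω * w ω

theorem invFourier_eq_timeMoment (w : ℝ → ℂ) : invFourier w = timeMoment w 0 := by
  ext t
  simp only [invFourier, timeMoment, timeSymbol, pow_zero, one_mul]
  exact integral_congr_ae (ae_of_all _ fun ω => mul_comm _ _)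

theorem integrable_timeSymbol_mul (hη : 0 < η)
    (hw : Integrable fun ω => (1 + (ω / η) ^ 2) • w ω) {k : ℕ} (hk : k ≤ 2) (t : ℝ) :
    Integrable fun ω => timeSymbol k t ω * w ω :=
  integrable_mul_of_weighted hw (continuous_timeSymbol k t) (norm_timeSymbol_le hη hk t)

theorem norm_timeMoment_le (hη : 0 < η)
    (hw : Integrable fun ω => (1 + (ω / η) ^ 2) • w ω) {k : ℕ} (hk : k ≤ 2) (t : ℝ) :
    ‖timeMoment w k t‖ ≤ η ^ k * ∫ ω, ‖(1 + (ω / η) ^ 2) • w ω‖ :=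
  norm_integral_mul_le_of_weighted hw (norm_timeSymbol_le hη hk t)

/-- Differentiation under the integral. The modulus of the symbol does not depend on time, so the
integrand at the single time `t` dominates for all times. -/
theorem hasDerivAt_timeMoment (hη : 0 < η)
    (hw : Integrable fun ω => (1 + (ω / η) ^ 2) • w ω) {k : ℕ} (hk : k ≤ 1) (t : ℝ) :
    HasDerivAt (timeMoment w k) (timeMoment w (k + 1) t) t := by
  refine (hasDerivAt_integral_of_dominated_loc_of_deriv_le (μ := volume) (s := Set.univ)
    (F := fun τ ω => timeSymbol k τ ω * w ω)
    (F' := fun τ ω => timeSymbol (k + 1) τ ω * w ω)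
    (bound := fun ω => ‖timeSymbol (k + 1) t ω * w ω‖) univ_mem
    (Eventually.of_forall fun τ =>
      (integrable_timeSymbol_mul hη hw (by omega) τ).aestronglyMeasurable)
    (integrable_timeSymbol_mul hη hw (by omega) t)
    (integrable_timeSymbol_mul hη hw (by omega) t).aestronglyMeasurable
    (ae_of_all _ fun ω τ _ => ?_)
    (integrable_timeSymbol_mul hη hw (by omega) t).norm
    (ae_of_all _ fun ω τ _ => (hasDerivAt_timeSymbol k τ ω).mul_const (w ω))).2
  rw [norm_mul, norm_mul, norm_timeSymbol, norm_timeSymbol]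

theorem deriv_timeMoment_zero (hη : 0 < η) (hw : Integrable fun ω => (1 + (ω / η) ^ 2) • w ω) :
    deriv (timeMoment w 0) = timeMoment w 1 :=
  funext fun t => (hasDerivAt_timeMoment hη hw (by norm_num) t).deriv

end Fourier

/-! ### Averages over a resonator and Fubini. -/

section Mean

variable {N : ℕ} {g : Geometry N} {v : ℝ → ℝ → ℂ} {η A : ℝ}

/-- The moment bound is uniform in x and the interval has finite measure, so joint measurability
yields integrability on the product. All exchanges of the x and ω integrals rest on this. -/
theorem integrable_prod_of_isLowFrequency (hv : IsLowFrequency v η A) {φ : ℝ → ℂ}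
    (hφ : Continuous φ) {c : ℝ} (hc : ∀ ω, ‖φ ω‖ ≤ c * (1 + (ω / η) ^ 2)) (a b : ℝ) :
    Integrable (Function.uncurry fun x ω => φ ω * v x ω)
      ((volume.restrict (Set.Ioo a b)).prod volume) := by
  have hm : AEStronglyMeasurable (Function.uncurry fun x ω => φ ω * v x ω)
      ((volume.restrict (Set.Ioo a b)).prod volume) := by
    refine AEStronglyMeasurable.mul (f := fun p : ℝ × ℝ => φ p.2)
      (g := Function.uncurry v) (hφ.comp continuous_snd).aestronglyMeasurable ?_
    rw [Measure.restrict_prod_eq_prod_univ]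
    exact hv.measurable.restrict
  have hc0 : 0 ≤ c := by
    have := (norm_nonneg _).trans (hc 0)
    simpa using this
  rw [integrable_prod_iff hm]
  refine ⟨ae_of_all _ fun x => integrable_mul_of_weighted (hv.integrable x) hφ hc, ?_⟩
  refine Integrable.of_bound hm.norm.integral_prod_right' (c * A) (ae_of_all _ fun x => ?_)
  rw [Real.norm_of_nonneg (integral_nonneg fun _ => norm_nonneg _)]
  refine le_trans ?_ (mul_le_mul_of_nonneg_left (hv.moment x) hc0)
  rw [← integral_const_mul]
  refine integral_mono (integrable_mul_of_weighted (hv.integrable x) hφ hc).norm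
    ((hv.integrable x).norm.const_mul c) fun ω => ?_
  simp only [Function.uncurry, norm_mul, norm_smul, Real.norm_of_nonneg (weight_pos η ω).le]
  rw [← mul_assoc]
  exact mul_le_mul_of_nonneg_right (hc ω) (norm_nonneg _)

theorem Geometry.len_pos (g : Geometry N) (i : Fin N) : 0 < g.len i :=
  sub_pos.2 (g.xl_lt_xr i)

theorem weighted_resonatorAmplitude (hv : IsLowFrequency v η A) (i : Fin N) :
    Integrable fun ω => (1 + (ω / η) ^ 2) • resonatorAmplitude g v i ω := by
  have h := (integrable_prod_of_isLowFrequency hv (φ := fun ω => ((1 + (ω / η) ^ 2 : ℝ) : ℂ))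
    (by fun_prop) (c := 1) (fun ω => by
      rw [Complex.norm_real, Real.norm_of_nonneg (weight_pos η ω).le, one_mul])
    (g.xl i) (g.xr i)).integral_prod_right
  refine (h.smul (g.len i)⁻¹).congr (ae_of_all _ fun ω => ?_)
  simp only [Pi.smul_apply, Function.uncurry, resonatorAmplitude, integral_const_mul]
  rw [smul_comm (1 + (ω / η) ^ 2), ← Complex.real_smul]

/-- By Fubini, taking the mean over a resonator commutes with up to two time derivatives. -/
theorem setIntegral_timeMoment (hη : 0 < η) (hv : IsLowFrequency v η A) (i : Fin N) {k : ℕ}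
    (hk : k ≤ 2) (t : ℝ) :
    ∫ x in Set.Ioo (g.xl i) (g.xr i), timeMoment (v x) k t =
      g.len i • timeMoment (resonatorAmplitude g v i) k t := by
  have h := integrable_prod_of_isLowFrequency hv (continuous_timeSymbol k t)
    (norm_timeSymbol_le hη hk t) (g.xl i) (g.xr i)
  unfold timeMoment
  rw [integral_integral_swap h, ← integral_smul]
  refine integral_congr_ae (ae_of_all _ fun ω => ?_)
  simp only [resonatorAmplitude, integral_const_mul]
  rw [mul_smul_comm, smul_smul, mul_inv_cancel₀ (g.len_pos i).ne', one_smul]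

theorem integrableOn_timeMoment (hη : 0 < η) (hv : IsLowFrequency v η A) (a b : ℝ) {k : ℕ}
    (hk : k ≤ 2) (t : ℝ) :
    IntegrableOn (fun x => timeMoment (v x) k t) (Set.Ioo a b) :=
  (integrable_prod_of_isLowFrequency hv (continuous_timeSymbol k t)
    (norm_timeSymbol_le hη hk t) a b).integral_prod_left

end Mean

end TimeLocalisation

namespace TimeLocalisation

/-! ### Functions of one variable with small second derivative. -/

section Calculus

variable {f : ℝ → ℂ} {a b B : ℝ} {p P Q : ℂ} {l : Filter ℝ}

/-- A bound of the second derivative controls how far the first one is from its limits. -/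
theorem norm_deriv_sub_limit_le (hf' : ∀ x ∈ Set.Ioo a b, DifferentiableAt ℝ (deriv f) x)
    (hB : ∀ x ∈ Set.Ioo a b, ‖deriv (deriv f) x‖ ≤ B) [l.NeBot] (hl : Set.Ioo a b ∈ l)
    (hp : Tendsto (deriv f) l (𝓝 p)) {x : ℝ} (hx : x ∈ Set.Ioo a b) :
    ‖deriv f x - p‖ ≤ B * (b - a) := by
  have hB0 : 0 ≤ B := (norm_nonneg _).trans (hB x hx)
  refine le_of_tendsto (tendsto_const_nhds.sub hp).norm ?_
  filter_upwards [hl] with y hy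
  refine ((convex_Ioo a b).norm_image_sub_le_of_norm_deriv_le hf' hB hy hx).trans ?_
  gcongr
  rw [Real.norm_eq_abs, abs_le]
  constructor <;> linarith [hx.1, hx.2, hy.1, hy.2]

/-- After subtracting the line of slope `p`, the derivative is at most B(b - a), so the remainder
varies by at most B(b - a)² between the end limits; then divide by b - a. Only one-sided limits of
`f` enter because the field jumps at the interfaces, and the filter `l` is free so that either end
can be used. -/
theorem norm_slope_sub_limit_le (hab : a < b)
    (hf : ∀ x ∈ Set.Ioo a b, DifferentiableAt ℝ f x)
    (hf' : ∀ x ∈ Set.Ioo a b, DifferentiableAt ℝ (deriv f) x)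
    (hB : ∀ x ∈ Set.Ioo a b, ‖deriv (deriv f) x‖ ≤ B) [l.NeBot] (hl : Set.Ioo a b ∈ l)
    (hp : Tendsto (deriv f) l (𝓝 p)) (hP : Tendsto f (𝓝[>] a) (𝓝 P))
    (hQ : Tendsto f (𝓝[<] b) (𝓝 Q)) :
    ‖p - (b - a)⁻¹ • (Q - P)‖ ≤ B * (b - a) := by
  have hB0 : 0 ≤ B := (norm_nonneg _).trans (hB ((a + b) / 2) ⟨by linarith, by linarith⟩)
  have hd : 0 < b - a := sub_pos.2 hab
  let h : ℝ → ℂ := fun x => f x - x • p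
  have hid : ∀ x, HasDerivAt (fun x : ℝ => x • p) p x := fun x => by
    simpa using (hasDerivAt_id x).smul_const p
  have hh : ∀ x ∈ Set.Ioo a b, HasDerivAt h (deriv f x - p) x := fun x hx =>
    (hf x hx).hasDerivAt.sub (hid x)
  have key : ∀ x ∈ Set.Ioo a b, ∀ y ∈ Set.Ioo a b, ‖h y - h x‖ ≤ B * (b - a) * (b - a) := by
    intro x hx y hy
    refine ((convex_Ioo a b).norm_image_sub_le_of_norm_deriv_le
      (fun z hz => (hh z hz).differentiableAt) (fun z hz => by
        rw [(hh z hz).deriv]; exact norm_deriv_sub_limit_le hf' hB hl hp hz) hx hy).trans ?_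
    gcongr
    rw [Real.norm_eq_abs, abs_le]
    constructor <;> linarith [hx.1, hx.2, hy.1, hy.2]
  have hla : Tendsto h (𝓝[>] a) (𝓝 (P - a • p)) :=
    hP.sub ((hid a).continuousAt.tendsto.mono_left nhdsWithin_le_nhds)
  have hlb : Tendsto h (𝓝[<] b) (𝓝 (Q - b • p)) :=
    hQ.sub ((hid b).continuousAt.tendsto.mono_left nhdsWithin_le_nhds)
  have h1 : ∀ x ∈ Set.Ioo a b, ‖(Q - b • p) - h x‖ ≤ B * (b - a) * (b - a) := fun x hx => by
    refine le_of_tendsto (hlb.sub tendsto_const_nhds).norm ?_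
    filter_upwards [Ioo_mem_nhdsLT hab] with y hy using key x hx y hy
  have h2 : ‖(Q - b • p) - (P - a • p)‖ ≤ B * (b - a) * (b - a) := by
    refine le_of_tendsto (tendsto_const_nhds.sub hla).norm ?_
    filter_upwards [Ioo_mem_nhdsGT hab] with y hy using h1 y hy
  have e : p - (b - a)⁻¹ • (Q - P) = (-(b - a)⁻¹) • ((Q - b • p) - (P - a • p)) := by
    have : p = (b - a)⁻¹ • ((b - a) • p) := by
      rw [smul_smul, inv_mul_cancel₀ hd.ne', one_smul]
    conv_lhs => rw [this]
    rw [← smul_sub, neg_smul, ← smul_neg]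
    congr 1
    rw [sub_smul]
    ring
  rw [e, norm_smul, norm_neg, norm_inv, Real.norm_of_nonneg hd.le, inv_mul_le_iff₀ hd]
  linarith

/-- On an interval where `f'' = 0` the one-sided limits of `f'` are the slope of `f`. -/
theorem tendsto_deriv_of_harmonic (hab : a < b)
    (hf : ∀ x ∈ Set.Ioo a b, DifferentiableAt ℝ f x)
    (hf' : ∀ x ∈ Set.Ioo a b, DifferentiableAt ℝ (deriv f) x)
    (h0 : ∀ x ∈ Set.Ioo a b, deriv (deriv f) x = 0) (hc : Continuous f)
    [l.NeBot] (hl : Set.Ioo a b ∈ l) :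
    Tendsto (deriv f) l (𝓝 ((b - a)⁻¹ • (f b - f a))) := by
  have hm : (a + b) / 2 ∈ Set.Ioo a b := ⟨by linarith, by linarith⟩
  have hconst : ∀ x ∈ Set.Ioo a b, deriv f x = deriv f ((a + b) / 2) := by
    intro x hx
    have := (convex_Ioo a b).norm_image_sub_le_of_norm_deriv_le (C := 0) hf'
      (fun y hy => by rw [h0 y hy, norm_zero]) hm hx
    rw [zero_mul] at this
    exact sub_eq_zero.1 (norm_le_zero_iff.1 this)
  have ht : Tendsto (deriv f) l (𝓝 (deriv f ((a + b) / 2))) := by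
    refine tendsto_const_nhds.congr' ?_
    filter_upwards [hl] with x hx using (hconst x hx).symm
  -- With `B = 0` the slope estimate is an equality and identifies the constant value of the
  -- derivative.
  have h := norm_slope_sub_limit_le (B := 0) hab hf hf'
    (fun y hy => by rw [h0 y hy, norm_zero]) hl ht
    (hc.continuousAt.tendsto.mono_left nhdsWithin_le_nhds)
    (hc.continuousAt.tendsto.mono_left nhdsWithin_le_nhds)
  rw [zero_mul] at h
  rwa [sub_eq_zero.1 (norm_le_zero_iff.1 h)] at ht

/-- The deviation of a function from its mean, in terms of its derivatives. -/
theorem norm_sub_mean_le (hab : a < b) {m : ℂ} (hint : IntegrableOn f (Set.Ioo a b))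
    (hm : ∫ x in Set.Ioo a b, f x = (b - a) • m) {D : ℝ}
    (hf : ∀ x ∈ Set.Ioo a b, DifferentiableAt ℝ f x)
    (hD : ∀ x ∈ Set.Ioo a b, ‖deriv f x‖ ≤ D) {x : ℝ} (hx : x ∈ Set.Ioo a b) :
    ‖f x - m‖ ≤ D * (b - a) := by
  have hd : 0 < b - a := sub_pos.2 hab
  have hD0 : 0 ≤ D := (norm_nonneg _).trans (hD x hx)
  have hvol : volume.real (Set.Ioo a b) = b - a := by
    rw [measureReal_def, Real.volume_Ioo, ENNReal.toReal_ofReal hd.le]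
  have e : (b - a) • (f x - m) = ∫ y in Set.Ioo a b, (f x - f y) := by
    rw [integral_sub (by simp) hint, hm, setIntegral_const, hvol, smul_sub]
  have h := norm_setIntegral_le_of_norm_le_const (μ := volume) (s := Set.Ioo a b)
    (f := fun y => f x - f y) (C := D * (b - a)) (by simp) fun y hy => by
      refine ((convex_Ioo a b).norm_image_sub_le_of_norm_deriv_le hf hD hy hx).trans ?_
      gcongr
      rw [Real.norm_eq_abs, abs_le]
      constructor <;> linarith [hx.1, hx.2, hy.1, hy.2]
  rw [← e, norm_smul, Real.norm_of_nonneg hd.le, hvol, mul_comm] at h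
  exact le_of_mul_le_mul_right h hd

end Calculus

/-! ### Bounds for the modulation and its time derivative. -/

namespace Modulation

variable {N : ℕ} {md : Modulation N} {δ γ K : ℝ}

theorem norm_trig (n : ℤ) (Ω t : ℝ) : ‖Complex.exp (Complex.I * n * Ω * t)‖ = 1 := by
  have : Complex.I * n * Ω * t = ((n * Ω * t : ℝ) : ℂ) * Complex.I := by push_cast; ring
  rw [this, Complex.norm_exp_ofReal_mul_I]

theorem norm_trigPoly_le (S : Finset ℤ) (c : ℤ → ℂ) (Ω t : ℝ) :
    ‖∑ n ∈ S, c n * Complex.exp (Complex.I * n * Ω * t)‖ ≤ ∑ n ∈ S, ‖c n‖ := by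
  refine (norm_sum_le _ _).trans (Finset.sum_le_sum fun n _ => ?_)
  rw [norm_mul, norm_trig, mul_one]

theorem abs_inv_s_le (h : md.IsSubwavelength δ γ K) (i : Fin N) (t : ℝ) :
    |(md.s i t)⁻¹| ≤ K := by
  rw [← Real.norm_eq_abs, ← Complex.norm_real, md.inv_s]
  exact (norm_trigPoly_le _ _ _ _).trans (h.source i)

/-- The sign of `K` is not assumed; the source bound forces it as soon as there is a resonator. -/
theorem K_nonneg (h : md.IsSubwavelength δ γ K) (i : Fin N) : 0 ≤ K :=
  (abs_nonneg _).trans (abs_inv_s_le h i 0)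

theorem abs_invκ_le (h : md.IsSubwavelength δ γ K) (i : Fin N) (t : ℝ) :
    |md.invκ i t| ≤ 2 * K := by
  have h1 : |(md.κp i t)⁻¹| ≤ K := by
    rw [← Real.norm_eq_abs, ← Complex.norm_real, md.inv_κp]
    exact (norm_trigPoly_le _ _ _ _).trans (h.periodic i)
  unfold invκ
  linarith [abs_add_le (md.κp i t)⁻¹ (md.c i * md.f t), h.defect i t]

/-- Differentiating the trigonometric polynomial brings down factors of size at most MΩ ≤ K² δ^(-γ/2
+ 1/2), which is exactly the scale η. The coefficient sum contributes one more `K`, and the defect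
adds the separate `K`. -/
theorem exists_hasDerivAt_invκ (hδ : 0 < δ) (h : md.IsSubwavelength δ γ K) (i : Fin N) (t : ℝ) :
    ∃ r : ℝ, HasDerivAt (md.invκ i) r t ∧ |r| ≤ (K ^ 3 + K) * δ ^ ((1 - γ) / 2) := by
  set S := Finset.Icc (-(md.M : ℤ)) md.M with hS
  let d : ℂ := ∑ n ∈ S, md.k i n * (Complex.exp (Complex.I * n * md.Ω * t) *
    (Complex.I * n * md.Ω))
  have hd : HasDerivAt (fun τ : ℝ => (((md.κp i τ)⁻¹ : ℝ) : ℂ)) d t := by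
    simp only [md.inv_κp]
    refine HasDerivAt.fun_sum fun n _ => HasDerivAt.const_mul _ (HasDerivAt.cexp ?_)
    simpa using (Complex.ofRealCLM.hasDerivAt (x := t)).const_mul (Complex.I * n * md.Ω)
  -- The polynomial has complex terms but real values, so the real derivative is the real part.
  have hre : HasDerivAt (fun τ => (md.κp i τ)⁻¹) d.re t := by
    exact Complex.reCLM.hasFDerivAt.comp_hasDerivAt t hd
  have hK := K_nonneg h i
  have hΩ := md.Ω_pos
  have hMΩ : (md.M : ℝ) * md.Ω ≤ K ^ 2 * δ ^ ((1 - γ) / 2) := by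
    have e : δ ^ ((1 - γ) / 2) = δ ^ (-γ / 2) * δ ^ ((1 : ℝ) / 2) := by
      rw [← Real.rpow_add hδ]; congr 1; ring
    calc (md.M : ℝ) * md.Ω ≤ (K * δ ^ (-γ / 2)) * (K * δ ^ ((1 : ℝ) / 2)) :=
          mul_le_mul h.degree h.frequency hΩ.le (by positivity)
      _ = K ^ 2 * δ ^ ((1 - γ) / 2) := by rw [e]; ring
  have hdle : ‖d‖ ≤ K * (K ^ 2 * δ ^ ((1 - γ) / 2)) := by
    calc ‖d‖ ≤ ∑ n ∈ S, ‖md.k i n‖ * (md.M * md.Ω) := by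
          refine (norm_sum_le _ _).trans (Finset.sum_le_sum fun n hn => ?_)
          rw [norm_mul, norm_mul, norm_trig, one_mul, norm_mul, norm_mul, Complex.norm_I, one_mul,
            Complex.norm_real, Real.norm_of_nonneg hΩ.le, Complex.norm_intCast]
          have : |(n : ℝ)| ≤ md.M := by
            rw [hS, Finset.mem_Icc] at hn
            rw [abs_le]
            exact ⟨by exact_mod_cast hn.1, by exact_mod_cast hn.2⟩
          gcongr
      _ = (∑ n ∈ S, ‖md.k i n‖) * (md.M * md.Ω) := by rw [Finset.sum_mul]
      _ ≤ K * (K ^ 2 * δ ^ ((1 - γ) / 2)) :=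
          mul_le_mul (h.periodic i) hMΩ (by positivity) hK
  refine ⟨d.re + md.c i * deriv md.f t,
    hre.add ((md.differentiable_f t).hasDerivAt.const_mul _), ?_⟩
  have h1 := abs_add_le d.re (md.c i * deriv md.f t)
  have h2 := Complex.abs_re_le_norm d
  have h3 := h.defect_deriv i t
  nlinarith

end Modulation

end TimeLocalisation

namespace TimeLocalisation

/-! ### Gaps between neighbouring resonators, and the capacitance matrix in terms of slopes. -/

namespace Geometry

variable {N : ℕ} {g : Geometry N}

/-- The distance from the right end of the resonator `p` to the left end of the resonator `q`. -/
noncomputable def gap (g : Geometry N) (p q : Fin N × ℤ) : ℝ := g.left q.1 q.2 - g.right p.1 p.2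

/-- The resonator `q` is the next one to the right of the resonator `p`. -/
structure IsGap (g : Geometry N) (p q : Fin N × ℤ) : Prop where
  lt : g.right p.1 p.2 < g.left q.1 q.2
  subset : Set.Ioo (g.right p.1 p.2) (g.left q.1 q.2) ⊆ g.exterior

theorem IsGap.gap_pos {p q : Fin N × ℤ} (h : g.IsGap p q) : 0 < g.gap p q := sub_pos.2 h.lt

theorem left_zero (g : Geometry N) (i : Fin N) : g.left i 0 = g.xl i := by simp [left]

theorem right_zero (g : Geometry N) (i : Fin N) : g.right i 0 = g.xr i := by simp [right]

theorem left_lt_right (g : Geometry N) (i : Fin N) (m : ℤ) : g.left i m < g.right i m := by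
  have := g.xl_lt_xr i
  simp only [left, right]
  linarith

theorem exists_isGap (g : Geometry N) (j : Fin N) :
    ∃ p q, g.IsGap p (j, 0) ∧ g.IsGap (j, 0) q := by
  obtain ⟨a, b, ha, hb, ⟨ia, ma, rfl⟩, ⟨ib, mb, rfl⟩, hnb⟩ := g.exists_neighbours j
  have hj := g.xl_lt_xr j
  refine ⟨(ia, ma), (ib, mb), ⟨by simpa [left_zero] using ha, ?_⟩,
    ⟨by simpa [right_zero] using hb, ?_⟩⟩
  · rintro x ⟨h1, h2⟩ i m ⟨h3, h4⟩
    simp only [left_zero] at h2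
    by_cases him : i = j ∧ m = 0
    · obtain ⟨rfl, rfl⟩ := him
      rw [left_zero] at h3
      linarith
    · rcases hnb i m him with h | h <;> linarith
  · rintro x ⟨h1, h2⟩ i m ⟨h3, h4⟩
    simp only [right_zero] at h1
    by_cases him : i = j ∧ m = 0
    · obtain ⟨rfl, rfl⟩ := him
      rw [right_zero] at h4
      linarith
    · rcases hnb i m him with h | h <;> linarith

/-- There are finitely many resonators in the cell, so common bounds exist. They make the final
constant depend on the gaps only through the geometry. -/
theorem exists_gap_bounds (g : Geometry N) : ∃ G H : ℝ, ∀ j, ∃ p q,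
    g.IsGap p (j, 0) ∧ g.IsGap (j, 0) q ∧ (g.gap p (j, 0))⁻¹ ≤ G ∧ g.gap p (j, 0) ≤ H ∧
      (g.gap (j, 0) q)⁻¹ ≤ G ∧ g.gap (j, 0) q ≤ H := by
  choose p q hp hq using g.exists_isGap
  obtain ⟨G₁, h1⟩ := Finite.exists_le fun j => (g.gap (p j) (j, 0))⁻¹
  obtain ⟨G₂, h2⟩ := Finite.exists_le fun j => (g.gap (j, 0) (q j))⁻¹
  obtain ⟨H₁, h3⟩ := Finite.exists_le fun j => g.gap (p j) (j, 0)
  obtain ⟨H₂, h4⟩ := Finite.exists_le fun j => g.gap (j, 0) (q j)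
  exact ⟨max G₁ G₂, max H₁ H₂, fun j => ⟨p j, q j, hp j, hq j, (h1 j).trans (le_max_left _ _),
    (h3 j).trans (le_max_left _ _), (h2 j).trans (le_max_right _ _),
    (h4 j).trans (le_max_right _ _)⟩⟩

theorem len_le_L (g : Geometry N) (i : Fin N) : g.len i ≤ g.L := by
  unfold len
  linarith [g.xl_pos i, g.xr_lt_L i]

/-- The quasiperiodicity factor of the `m`-th cell. -/
noncomputable def phase (g : Geometry N) (α : ℝ) (m : ℤ) : ℂ :=
  Complex.exp (Complex.I * α * m * g.L)

theorem norm_phase (α : ℝ) (m : ℤ) : ‖g.phase α m‖ = 1 := by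
  have : Complex.I * α * m * g.L = ((α * m * g.L : ℝ) : ℂ) * Complex.I := by push_cast; ring
  rw [phase, this, Complex.norm_exp_ofReal_mul_I]

theorem phase_add_one (α : ℝ) (m : ℤ) :
    g.phase α (m + 1) = Complex.exp (Complex.I * α * g.L) * g.phase α m := by
  rw [phase, phase, ← Complex.exp_add]
  congr 1
  push_cast
  ring

theorem quasiperiodic_int {f : ℝ → ℂ} {α : ℝ}
    (hf : ∀ x, f (x + g.L) = Complex.exp (Complex.I * α * g.L) * f x) (x : ℝ) (m : ℤ) :
    f (x + m * g.L) = g.phase α m * f x := by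
  have step : ∀ k : ℤ, f (x + (k + 1 : ℤ) * g.L) =
      Complex.exp (Complex.I * α * g.L) * f (x + k * g.L) := fun k => by
    rw [← hf]
    congr 1
    push_cast
    ring
  induction m using Int.induction_on with
  | zero => simp [phase]
  | succ k ih =>
    rw [step, ih, phase_add_one]
    ring
  | pred k ih =>
    have h1 := step (-k - 1)
    have h2 := phase_add_one (g := g) α (-k - 1)
    rw [sub_add_cancel] at h1 h2
    rw [ih, h2, mul_assoc] at h1
    exact (mul_left_cancel₀ (Complex.exp_ne_zero _) h1).symm

section Potential

variable {α : ℝ} {i j : Fin N} {V : ℝ → ℂ} {p q : Fin N × ℤ}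

/-- The defining values are prescribed on open resonators only; continuity carries them to the end
points, where the slopes are computed. -/
theorem IsPotential.on_closure (hV : g.IsPotential α j V) {x : ℝ}
    (hx : x ∈ Set.Icc (g.xl i) (g.xr i)) : V x = if j = i then 1 else 0 := by
  have h : Set.EqOn V (fun _ => if j = i then 1 else 0) (closure (g.resonator i 0)) :=
    Set.EqOn.closure (fun y hy => hV.on_resonator i y hy) hV.continuous continuous_const
  refine h ?_
  rwa [resonator, left_zero, right_zero, closure_Ioo (g.xl_lt_xr i).ne]

theorem IsPotential.left (hV : g.IsPotential α j V) (i : Fin N) (m : ℤ) :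
    V (g.left i m) = g.phase α m * if j = i then 1 else 0 := by
  rw [Geometry.left, hV.quasiperiodic, hV.on_closure (i := i) ⟨le_rfl, (g.xl_lt_xr i).le⟩, phase]

theorem IsPotential.right (hV : g.IsPotential α j V) (i : Fin N) (m : ℤ) :
    V (g.right i m) = g.phase α m * if j = i then 1 else 0 := by
  rw [Geometry.right, hV.quasiperiodic, hV.on_closure (i := i) ⟨(g.xl_lt_xr i).le, le_rfl⟩, phase]

/-- The slope of the quasiperiodic, piecewise affine interpolation of the values `z` between the
resonators `p` and `q`. -/
noncomputable def slope (g : Geometry N) (α : ℝ) (z : Fin N → ℂ) (p q : Fin N × ℤ) : ℂ :=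
  (g.gap p q)⁻¹ • (g.phase α q.2 * z q.1 - g.phase α p.2 * z p.1)

theorem IsPotential.tendsto_deriv (hV : g.IsPotential α j V) (hpq : g.IsGap p q) {l : Filter ℝ}
    [l.NeBot] (hl : Set.Ioo (g.right p.1 p.2) (g.left q.1 q.2) ∈ l) :
    Tendsto (deriv V) l (𝓝 (g.slope α (fun k => if j = k then 1 else 0) p q)) := by
  have h := tendsto_deriv_of_harmonic hpq.lt
    (fun x hx => hV.differentiableAt x (hpq.subset hx))
    (fun x hx => hV.differentiableAt_deriv x (hpq.subset hx))
    (fun x hx => neg_eq_zero.1 (hV.harmonic x (hpq.subset hx))) hV.continuous hl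
  rwa [hV.left, hV.right] at h

/-- The potential is affine on each gap, so both limits in the flux are slopes determined by its
values at the resonators. No other property of the chosen potential matters. -/
theorem capacitance_eq (hp : g.IsGap p (i, 0)) (hq : g.IsGap (i, 0) q) (α : ℝ) (j : Fin N) :
    g.capacitance α i j = g.slope α (fun k => if j = k then 1 else 0) p (i, 0) -
      g.slope α (fun k => if j = k then 1 else 0) (i, 0) q := by
  have hV : g.IsPotential α j (g.potential α j) := Classical.choose_spec (g.exists_isPotential α j)
  have h1 := hV.tendsto_deriv hp (Ioo_mem_nhdsLT hp.lt)
  have h2 := hV.tendsto_deriv hq (Ioo_mem_nhdsGT hq.lt)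
  rw [left_zero] at h1
  rw [right_zero] at h2
  simp only [capacitance, Matrix.of_apply, boundaryFlux, h1.limUnder_eq, h2.limUnder_eq]

/-- The slope is linear in the nodal values, and the indicator vectors form the standard basis. -/
theorem sum_slope (σ : Fin N → ℝ) (m : Fin N → ℂ) :
    ∑ j, σ j • (g.slope α (fun k => if j = k then 1 else 0) p q * m j) =
      g.slope α (fun k => σ k • m k) p q := by
  simp only [slope, Complex.real_smul, mul_sub, sub_mul, Finset.sum_sub_distrib]
  congr 1
  · rw [Finset.sum_eq_single q.1 (fun j _ hj => by simp [hj]) (by simp)]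
    simp only [if_true]
    ring
  · rw [Finset.sum_eq_single p.1 (fun j _ hj => by simp [hj]) (by simp)]
    simp only [if_true]
    ring

theorem sum_capacitance (hp : g.IsGap p (i, 0)) (hq : g.IsGap (i, 0) q) (α : ℝ) (σ : Fin N → ℝ)
    (m : Fin N → ℂ) :
    ∑ j, σ j • (g.capacitance α i j * m j) =
      g.slope α (fun k => σ k • m k) p (i, 0) - g.slope α (fun k => σ k • m k) (i, 0) q := by
  simp only [capacitance_eq hp hq, sub_mul, smul_sub, Finset.sum_sub_distrib, sum_slope]

end Potential

end Geometry

/-- A quasiperiodic field `f` at a fixed time, with means `m i` on the resonators, whose second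
derivative is at most `B` and which satisfies the transmission conditions with the reciprocal
sources `σ i`. -/
structure IsQuasistatic {N : ℕ} (g : Geometry N) (α δ : ℝ) (σ : Fin N → ℝ) (A B : ℝ)
    (f : ℝ → ℂ) (m : Fin N → ℂ) : Prop where
  bound : ∀ x, ‖f x‖ ≤ A
  exterior : ∀ x ∈ g.exterior, DifferentiableAt ℝ f x ∧ DifferentiableAt ℝ (deriv f) x ∧
    ‖deriv (deriv f) x‖ ≤ B
  interior : ∀ i, ∀ x ∈ Set.Ioo (g.xl i) (g.xr i), DifferentiableAt ℝ f x ∧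
    DifferentiableAt ℝ (deriv f) x ∧ ‖deriv (deriv f) x‖ ≤ B
  value_left : ∀ i k, Transmission f (𝓝[<] (g.left i k)) (𝓝[>] (g.left i k)) 1 (σ i)
  value_right : ∀ i k, Transmission f (𝓝[>] (g.right i k)) (𝓝[<] (g.right i k)) 1 (σ i)
  flux_left : ∀ i, Transmission (deriv f) (𝓝[<] (g.xl i)) (𝓝[>] (g.xl i)) δ (σ i)
  flux_right : ∀ i, Transmission (deriv f) (𝓝[>] (g.xr i)) (𝓝[<] (g.xr i)) δ (σ i)
  quasiperiodic : ∀ x, f (x + g.L) = Complex.exp (Complex.I * α * g.L) * f x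
  integrable : ∀ i, IntegrableOn f (Set.Ioo (g.xl i) (g.xr i))
  mean : ∀ i, ∫ x in Set.Ioo (g.xl i) (g.xr i), f x = g.len i • m i

/-! ### Estimates at a fixed time. -/

namespace IsQuasistatic

variable {N : ℕ} {g : Geometry N} {α δ A B : ℝ} {σ : Fin N → ℝ} {f : ℝ → ℂ} {m : Fin N → ℂ}
  {p q : Fin N × ℤ} {l : Filter ℝ} {D : ℂ} {i : Fin N}

theorem norm_sub_slope_le (h : IsQuasistatic g α δ σ A B f m) (hpq : g.IsGap p q)
    [l.NeBot] (hl : Set.Ioo (g.right p.1 p.2) (g.left q.1 q.2) ∈ l)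
    (hD : Tendsto (deriv f) l (𝓝 D)) {P Q : ℂ}
    (hP : Tendsto f (𝓝[>] (g.right p.1 p.2)) (𝓝 P))
    (hQ : Tendsto f (𝓝[<] (g.left q.1 q.2)) (𝓝 Q)) :
    ‖D - (g.gap p q)⁻¹ • (Q - P)‖ ≤ B * g.gap p q :=
  norm_slope_sub_limit_le hpq.lt (fun x hx => (h.exterior x (hpq.subset hx)).1)
    (fun x hx => (h.exterior x (hpq.subset hx)).2.1)
    (fun x hx => (h.exterior x (hpq.subset hx)).2.2) hl hD hP hQ

/-- The exterior normal derivatives are bounded. -/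
theorem norm_limit_le (h : IsQuasistatic g α δ σ A B f m) (hpq : g.IsGap p q)
    [l.NeBot] (hl : Set.Ioo (g.right p.1 p.2) (g.left q.1 q.2) ∈ l)
    (hD : Tendsto (deriv f) l (𝓝 D)) :
    ‖D‖ ≤ 2 * (g.gap p q)⁻¹ * A + B * g.gap p q := by
  obtain ⟨P, -, hP, -, -⟩ := h.value_right p.1 p.2
  obtain ⟨Q, -, hQ, -, -⟩ := h.value_left q.1 q.2
  have hd := hpq.gap_pos
  have h1 := h.norm_sub_slope_le hpq hl hD hP hQ
  have hPA : ‖P‖ ≤ A := le_of_tendsto hP.norm (Eventually.of_forall fun x => h.bound x)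
  have hQA : ‖Q‖ ≤ A := le_of_tendsto hQ.norm (Eventually.of_forall fun x => h.bound x)
  have h2 : ‖(g.gap p q)⁻¹ • (Q - P)‖ ≤ (g.gap p q)⁻¹ * (2 * A) := by
    rw [norm_smul, norm_inv, Real.norm_of_nonneg hd.le]
    gcongr
    linarith [norm_sub_le Q P]
  have h3 := norm_add_le (D - (g.gap p q)⁻¹ • (Q - P)) ((g.gap p q)⁻¹ • (Q - P))
  rw [sub_add_cancel] at h3
  linarith

/-- The weighted field deviates little from its mean on a resonator. -/
theorem norm_smul_sub_mean_le (h : IsQuasistatic g α δ σ A B f m) (hδ : 0 < δ)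
    (hp : g.IsGap p (i, 0)) {x : ℝ} (hx : x ∈ Set.Ioo (g.xl i) (g.xr i)) :
    ‖σ i • (f x - m i)‖ ≤ (δ * (2 * (g.gap p (i, 0))⁻¹ * A + B * g.gap p (i, 0)) +
      |σ i| * (B * g.len i)) * g.len i := by
  obtain ⟨D, D', hD, hD', hDD⟩ := h.flux_left i
  have hlt := g.xl_lt_xr i
  have h1 : ‖D‖ ≤ 2 * (g.gap p (i, 0))⁻¹ * A + B * g.gap p (i, 0) := by
    rw [← g.left_zero] at hD
    exact h.norm_limit_le hp (Ioo_mem_nhdsLT hp.lt) hD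
  have hder : ∀ y ∈ Set.Ioo (g.xl i) (g.xr i), ‖deriv (σ i • f) y‖ ≤
      δ * (2 * (g.gap p (i, 0))⁻¹ * A + B * g.gap p (i, 0)) + |σ i| * (B * g.len i) := by
    intro y hy
    have h2 := norm_deriv_sub_limit_le (fun z hz => (h.interior i z hz).2.1)
      (fun z hz => (h.interior i z hz).2.2) (Ioo_mem_nhdsGT hlt) hD' hy
    have e : deriv (σ i • f) y = δ • D + σ i • (deriv f y - D') := by
      rw [deriv_const_smul _ (h.interior i y hy).1, hDD, smul_sub]
      abel
    rw [e]
    refine (norm_add_le _ _).trans (add_le_add ?_ ?_)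
    · rw [norm_smul, Real.norm_of_nonneg hδ.le]
      gcongr
    · rw [norm_smul, Real.norm_eq_abs]
      gcongr
      exact h2
  rw [smul_sub]
  refine norm_sub_mean_le hlt (f := σ i • f) ((h.integrable i).smul (σ i)) ?_
    (fun y hy => (h.interior i y hy).1.const_smul (σ i)) hder hx
  simp only [Pi.smul_apply]
  rw [integral_smul, h.mean, smul_comm]
  rfl

/-- By the value condition, the outer limit `Q` is the weighted inner limit. Quasiperiodicity moves
the latter to the central cell at the cost of a unimodular phase, and there `hE` applies. -/
theorem norm_sub_phase_le (h : IsQuasistatic g α δ σ A B f m) {E : ℝ} {i : Fin N}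
    (hE : ∀ x ∈ Set.Ioo (g.xl i) (g.xr i), ‖σ i • (f x - m i)‖ ≤ E) {k : ℤ} {P Q : ℂ}
    {l : Filter ℝ} [l.NeBot] (hl : g.resonator i k ∈ l) (hP : Tendsto f l (𝓝 P))
    (hQ : (1 : ℝ) • Q = σ i • P) : ‖Q - g.phase α k * (σ i • m i)‖ ≤ E := by
  rw [one_smul] at hQ
  rw [hQ]
  refine le_of_tendsto ((hP.const_smul (σ i)).sub_const _).norm ?_
  filter_upwards [hl] with x hx
  have hx' : x - k * g.L ∈ Set.Ioo (g.xl i) (g.xr i) := by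
    simp only [Geometry.resonator, Geometry.left, Geometry.right] at hx
    exact ⟨by linarith [hx.1], by linarith [hx.2]⟩
  have e := Geometry.quasiperiodic_int h.quasiperiodic (x - k * g.L) k
  rw [sub_add_cancel] at e
  have e2 : σ i • f x - g.phase α k * (σ i • m i) =
      g.phase α k * (σ i • (f (x - k * g.L) - m i)) := by
    rw [e, mul_smul_comm, mul_smul_comm, mul_sub, smul_sub]
  rw [e2, norm_mul, Geometry.norm_phase, one_mul]
  exact hE _ hx'

theorem exists_limit_left (h : IsQuasistatic g α δ σ A B f m) {E : ℝ} {i : Fin N}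
    (hE : ∀ x ∈ Set.Ioo (g.xl i) (g.xr i), ‖σ i • (f x - m i)‖ ≤ E) (k : ℤ) :
    ∃ Q, Tendsto f (𝓝[<] (g.left i k)) (𝓝 Q) ∧ ‖Q - g.phase α k * (σ i • m i)‖ ≤ E := by
  obtain ⟨Q, P, hQ, hP, e⟩ := h.value_left i k
  exact ⟨Q, hQ, h.norm_sub_phase_le hE (Ioo_mem_nhdsGT (g.left_lt_right i k)) hP e⟩

theorem exists_limit_right (h : IsQuasistatic g α δ σ A B f m) {E : ℝ} {i : Fin N}
    (hE : ∀ x ∈ Set.Ioo (g.xl i) (g.xr i), ‖σ i • (f x - m i)‖ ≤ E) (k : ℤ) :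
    ∃ Q, Tendsto f (𝓝[>] (g.right i k)) (𝓝 Q) ∧ ‖Q - g.phase α k * (σ i • m i)‖ ≤ E := by
  obtain ⟨Q, P, hQ, hP, e⟩ := h.value_right i k
  exact ⟨Q, hQ, h.norm_sub_phase_le hE (Ioo_mem_nhdsLT (g.left_lt_right i k)) hP e⟩

/-- Two errors add up: `B * gap` for replacing the derivative by the slope between the true end
values, and one `E / gap` per end for replacing these values by the weighted means. -/
theorem norm_limit_sub_slope_le (h : IsQuasistatic g α δ σ A B f m) {E : ℝ}
    (hE : ∀ i, ∀ x ∈ Set.Ioo (g.xl i) (g.xr i), ‖σ i • (f x - m i)‖ ≤ E)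
    (hpq : g.IsGap p q) [l.NeBot] (hl : Set.Ioo (g.right p.1 p.2) (g.left q.1 q.2) ∈ l)
    (hD : Tendsto (deriv f) l (𝓝 D)) :
    ‖g.slope α (fun k => σ k • m k) p q - D‖ ≤ B * g.gap p q + 2 * (g.gap p q)⁻¹ * E := by
  obtain ⟨P, hP, hPE⟩ := h.exists_limit_right (hE p.1) p.2
  obtain ⟨Q, hQ, hQE⟩ := h.exists_limit_left (hE q.1) q.2
  have hd := hpq.gap_pos
  have h1 := h.norm_sub_slope_le hpq hl hD hP hQ
  have e : g.slope α (fun k => σ k • m k) p q - D =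
      -(D - (g.gap p q)⁻¹ • (Q - P)) + (g.gap p q)⁻¹ •
        ((P - g.phase α p.2 * (σ p.1 • m p.1)) - (Q - g.phase α q.2 * (σ q.1 • m q.1))) := by
    simp only [Geometry.slope, smul_sub]
    abel
  rw [e]
  refine (norm_add_le _ _).trans (add_le_add (by rwa [norm_neg]) ?_)
  rw [norm_smul, norm_inv, Real.norm_of_nonneg hd.le, mul_comm (2 : ℝ), mul_assoc]
  gcongr
  linarith [norm_sub_le (P - g.phase α p.2 * (σ p.1 • m p.1))
    (Q - g.phase α q.2 * (σ q.1 • m q.1))]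

end IsQuasistatic

end TimeLocalisation

/-! ### From the wave equation to the fixed-time estimates. -/

namespace TimeLocalisation

theorem IsLowFrequency.A_nonneg {v : ℝ → ℝ → ℂ} {η A : ℝ} (hv : IsLowFrequency v η A) : 0 ≤ A :=
  (integral_nonneg fun _ => norm_nonneg _).trans (hv.moment 0)

theorem IsLowFrequency.norm_timeMoment_le {v : ℝ → ℝ → ℂ} {η A : ℝ} (hv : IsLowFrequency v η A)
    (hη : 0 < η) {k : ℕ} (hk : k ≤ 2) (x t : ℝ) : ‖timeMoment (v x) k t‖ ≤ η ^ k * A :=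
  (TimeLocalisation.norm_timeMoment_le hη (hv.integrable x) hk t).trans
    (mul_le_mul_of_nonneg_left (hv.moment x) (by positivity))

theorem waveField_eq_timeMoment (v : ℝ → ℝ → ℂ) (x : ℝ) : waveField v x = timeMoment (v x) 0 :=
  invFourier_eq_timeMoment (v x)

theorem resonatorSignal_eq_timeMoment {N : ℕ} (g : Geometry N) (v : ℝ → ℝ → ℂ) (i : Fin N) :
    resonatorSignal g v i = timeMoment (resonatorAmplitude g v i) 0 :=
  invFourier_eq_timeMoment _

theorem hasDerivAt_smul_timeMoment {η : ℝ} (hη : 0 < η) {w : ℝ → ℂ}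
    (hw : Integrable fun ω => (1 + (ω / η) ^ 2) • w ω) {c : ℝ → ℝ} {r t : ℝ}
    (hc : HasDerivAt c r t) :
    HasDerivAt (fun τ => c τ • timeMoment w 1 τ) (r • timeMoment w 1 t + c t • timeMoment w 2 t)
      t := by
  rw [add_comm]
  exact hc.smul (hasDerivAt_timeMoment hη hw le_rfl t)

/-- The ratio between the second space derivative of a subwavelength field and `η² A`. -/
noncomputable def curvatureBound (v₀ vr K : ℝ) : ℝ := (K ^ 3 + 3 * K) / vr ^ 2 + 1 / v₀ ^ 2

section Solution

variable {N : ℕ} {g : Geometry N} {b : Bulk} {md : Modulation N} {v : ℝ → ℝ → ℂ}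
  {γ K A α : ℝ}

theorem Bulk.δ_pos (b : Bulk) : 0 < b.δ := div_pos b.ρr_pos b.ρ₀_pos

theorem Bulk.vr_sq (b : Bulk) : b.vr ^ 2 = b.κr / b.ρr :=
  Real.sq_sqrt (div_pos b.κr_pos b.ρr_pos).le

theorem scale_pos (b : Bulk) (γ : ℝ) : 0 < b.δ ^ ((1 - γ) / 2) := Real.rpow_pos_of_pos b.δ_pos _

theorem scale_sq (b : Bulk) (γ : ℝ) : (b.δ ^ ((1 - γ) / 2)) ^ 2 = b.δ ^ (1 - γ) := by
  rw [← Real.rpow_natCast, ← Real.rpow_mul b.δ_pos.le]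
  congr 1
  push_cast
  ring

theorem norm_curvature_exterior_le (hv₀ : 0 < b.v₀) (hv : IsLowFrequency v (b.δ ^ ((1 - γ) / 2)) A)
    (hu : IsSolution g b md (waveField v)) {x : ℝ} (hx : x ∈ g.exterior) (t : ℝ) :
    ‖deriv (deriv fun y => waveField v y t) x‖ ≤ 1 / b.v₀ ^ 2 * (b.δ ^ (1 - γ) * A) := by
  have hη := scale_pos b γ
  have e := hu.exterior_eq x hx t
  rw [waveField_eq_timeMoment v x, deriv_timeMoment_zero hη (hv.integrable x),
    (hasDerivAt_timeMoment hη (hv.integrable x) le_rfl t).deriv, sub_eq_zero] at e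
  have h := hv.norm_timeMoment_le hη le_rfl x t
  rw [e, scale_sq, norm_smul, Real.norm_of_nonneg (by positivity)] at h
  rw [one_div, le_inv_mul_iff₀ (by positivity)]
  exact h

theorem deriv_modulated_eq (hv : IsLowFrequency v (b.δ ^ ((1 - γ) / 2)) A)
    {i : Fin N} (x : ℝ) {t r : ℝ} (hr : HasDerivAt (md.invκ i) r t) :
    deriv (fun τ => md.invκ i τ • deriv (waveField v x) τ) t =
      r • timeMoment (v x) 1 t + md.invκ i t • timeMoment (v x) 2 t := by
  have hη := scale_pos b γ
  rw [waveField_eq_timeMoment v x, deriv_timeMoment_zero hη (hv.integrable x)]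
  exact (hasDerivAt_smul_timeMoment hη (hv.integrable x) hr).deriv

/-- The equation trades ∂ₓ² for time derivatives. In the product rule, the derivative of the
modulation gives (K³ + K)η times ηA and the modulation itself gives 2K times η²A, whence K³ + 3K. -/
theorem norm_curvature_interior_le (hvr : 0 < b.vr) (hmd : md.IsSubwavelength b.δ γ K)
    (hv : IsLowFrequency v (b.δ ^ ((1 - γ) / 2)) A)
    (hu : IsSolution g b md (waveField v)) {i : Fin N} {k : ℤ} {x : ℝ} (hx : x ∈ g.resonator i k)
    (t : ℝ) :
    ‖deriv (deriv fun y => waveField v y t) x‖ ≤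
      (K ^ 3 + 3 * K) / b.vr ^ 2 * (b.δ ^ (1 - γ) * A) := by
  have hη := scale_pos b γ
  have hA := hv.A_nonneg
  have hK := Modulation.K_nonneg hmd i
  obtain ⟨r, hr, hrb⟩ := Modulation.exists_hasDerivAt_invκ b.δ_pos hmd i t
  have e := hu.interior_eq i k x hx t
  rw [deriv_modulated_eq hv x hr, sub_eq_zero] at e
  have h1 := hv.norm_timeMoment_le hη (k := 1) (by norm_num) x t
  have h2 := hv.norm_timeMoment_le hη (k := 2) le_rfl x t
  have h3 : ‖b.vr ^ 2 • deriv (deriv fun y => waveField v y t) x‖ ≤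
      (K ^ 3 + 3 * K) * (b.δ ^ (1 - γ) * A) := by
    rw [← e, ← scale_sq]
    refine (norm_add_le _ _).trans ?_
    rw [norm_smul, norm_smul, Real.norm_eq_abs, Real.norm_eq_abs]
    have h4 := mul_le_mul hrb h1 (norm_nonneg _) (by positivity)
    have h5 := mul_le_mul (Modulation.abs_invκ_le hmd i t) h2 (norm_nonneg _) (by positivity)
    refine (add_le_add h4 h5).trans (le_of_eq ?_)
    ring
  rw [norm_smul, Real.norm_of_nonneg (by positivity)] at h3
  rw [div_mul_eq_mul_div, le_div_iff₀ (by positivity), mul_comm]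
  exact h3

theorem isQuasistatic_of_isSolution (hv₀ : 0 < b.v₀) (hvr : 0 < b.vr)
    (hmd : md.IsSubwavelength b.δ γ K) (hK : 0 ≤ K)
    (hv : IsLowFrequency v (b.δ ^ ((1 - γ) / 2)) A)
    (hq : ∀ x t, waveField v (x + g.L) t = Complex.exp (Complex.I * α * g.L) * waveField v x t)
    (hu : IsSolution g b md (waveField v)) (t : ℝ) :
    IsQuasistatic g α b.δ (fun i => (md.s i t)⁻¹) A
      (curvatureBound b.v₀ b.vr K * (b.δ ^ (1 - γ) * A))
      (fun x => waveField v x t) (fun i => resonatorSignal g v i t) := by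
  have hη := scale_pos b γ
  have hA := hv.A_nonneg
  have hδ : 0 ≤ b.δ ^ (1 - γ) := Real.rpow_nonneg b.δ_pos.le _
  have hmem : ∀ i x, x ∈ Set.Ioo (g.xl i) (g.xr i) → x ∈ g.resonator i 0 := fun i x hx => by
    rwa [Geometry.resonator, g.left_zero, g.right_zero]
  have hext : 1 / b.v₀ ^ 2 ≤ curvatureBound b.v₀ b.vr K :=
    le_add_of_nonneg_left (by positivity)
  have hint : (K ^ 3 + 3 * K) / b.vr ^ 2 ≤ curvatureBound b.v₀ b.vr K :=
    le_add_of_nonneg_right (by positivity)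
  refine
    { bound := fun x => ?_
      exterior := fun x hx => ⟨(hu.exterior_space x hx t).1, (hu.exterior_space x hx t).2,
        (norm_curvature_exterior_le hv₀ hv hu hx t).trans
          (mul_le_mul_of_nonneg_right hext (by positivity))⟩
      interior := fun i x hx => ⟨(hu.interior_space i 0 x (hmem i x hx) t).1,
        (hu.interior_space i 0 x (hmem i x hx) t).2,
        (norm_curvature_interior_le hvr hmd hv hu (hmem i x hx) t).trans
          (mul_le_mul_of_nonneg_right hint (by positivity))⟩
      value_left := fun i k => hu.value_left i k t
      value_right := fun i k => hu.value_right i k t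
      flux_left := fun i => by simpa only [g.left_zero] using hu.flux_left i 0 t
      flux_right := fun i => by simpa only [g.right_zero] using hu.flux_right i 0 t
      quasiperiodic := fun x => hq x t
      integrable := fun i => ?_
      mean := fun i => ?_ }
  · have h := hv.norm_timeMoment_le hη (k := 0) (by norm_num) x t
    rwa [pow_zero, one_mul, ← waveField_eq_timeMoment] at h
  · simp only [waveField_eq_timeMoment]
    exact integrableOn_timeMoment hη hv _ _ (by norm_num) t
  · simp only [waveField_eq_timeMoment, resonatorSignal_eq_timeMoment]
    exact setIntegral_timeMoment hη hv i (by norm_num) t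

/-- The modulated wave equation, averaged over a resonator. -/
theorem len_smul_deriv_modulated_eq (hvr : 0 < b.vr) (hmd : md.IsSubwavelength b.δ γ K)
    (hv : IsLowFrequency v (b.δ ^ ((1 - γ) / 2)) A)
    (hu : IsSolution g b md (waveField v)) (i : Fin N) (t : ℝ) {D₁ D₂ : ℂ}
    (h1 : Tendsto (deriv fun y => waveField v y t) (𝓝[>] (g.xl i)) (𝓝 D₁))
    (h2 : Tendsto (deriv fun y => waveField v y t) (𝓝[<] (g.xr i)) (𝓝 D₂)) :
    g.len i • deriv (fun τ => md.invκ i τ • deriv (resonatorSignal g v i) τ) t =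
      b.vr ^ 2 • (D₂ - D₁) := by
  have hη := scale_pos b γ
  have hlt := g.xl_lt_xr i
  have hmem : ∀ x ∈ Set.Ioo (g.xl i) (g.xr i), x ∈ g.resonator i 0 := fun x hx => by
    rwa [Geometry.resonator, g.left_zero, g.right_zero]
  have hw := weighted_resonatorAmplitude hv (g := g) i
  obtain ⟨r, hr, -⟩ := Modulation.exists_hasDerivAt_invκ b.δ_pos hmd i t
  -- The second derivative need not be continuous: a derivative is measurable, and the curvature
  -- bound does the rest.
  have hI : IntegrableOn (deriv (deriv fun y => waveField v y t))
      (Set.Ioo (g.xl i) (g.xr i)) := by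
    refine Measure.integrableOn_of_bounded (M := (K ^ 3 + 3 * K) / b.vr ^ 2 * (b.δ ^ (1 - γ) * A))
      (by simp) (stronglyMeasurable_deriv _).aestronglyMeasurable ?_
    filter_upwards [ae_restrict_mem measurableSet_Ioo] with x hx
    exact norm_curvature_interior_le hvr hmd hv hu (hmem x hx) t
  have hftc : ∫ x in Set.Ioo (g.xl i) (g.xr i), deriv (deriv fun y => waveField v y t) x =
      D₂ - D₁ := by
    rw [← integral_Ioc_eq_integral_Ioo, ← intervalIntegral.integral_of_le hlt.le]
    exact intervalIntegral.integral_eq_sub_of_hasDerivAt_of_tendsto hlt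
      (fun x hx => (hu.interior_space i 0 x (hmem x hx) t).2.hasDerivAt)
      ((intervalIntegrable_iff_integrableOn_Ioo_of_le hlt.le).2 hI) h1 h2
  -- Both sides become integrals over the resonator, where the claim is the wave equation at each
  -- point.
  rw [resonatorSignal_eq_timeMoment, deriv_timeMoment_zero hη hw,
    (hasDerivAt_smul_timeMoment hη hw hr).deriv, ← hftc, ← integral_smul, smul_add,
    smul_comm _ r, smul_comm _ (md.invκ i t),
    ← setIntegral_timeMoment hη hv i (by norm_num), ← setIntegral_timeMoment hη hv i le_rfl,
    ← integral_smul, ← integral_smul]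
  refine (integral_add ((integrableOn_timeMoment hη hv _ _ (by norm_num) t).smul r)
    ((integrableOn_timeMoment hη hv _ _ le_rfl t).smul (md.invκ i t))).symm.trans ?_
  refine setIntegral_congr_fun measurableSet_Ioo fun x hx => ?_
  simp only [Pi.smul_apply]
  rw [← deriv_modulated_eq hv x hr]
  exact sub_eq_zero.1 (hu.interior_eq i 0 x (hmem x hx) t)

end Solution

/-- The ratio between the oscillation on the resonators and `η² A`, for gaps of length at most `H`
with reciprocals at most `G`. -/
noncomputable def oscillationBound (G H L S K : ℝ) : ℝ := (2 * G + S * H + K * S * L) * L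

/-- The oscillation estimate with all terms at the single order ε A: δ ≤ ε is used for the term δ G
A, and δ ≤ 1 for the curvature term, which already carries ε. -/
theorem IsQuasistatic.norm_smul_sub_mean_le_oscillationBound {N : ℕ} {g : Geometry N}
    {α δ A S ε K G H : ℝ} {σ : Fin N → ℝ} {f : ℝ → ℂ} {m : Fin N → ℂ} {p : Fin N × ℤ} {i : Fin N}
    (h : IsQuasistatic g α δ σ A (S * (ε * A)) f m) (hδ : 0 < δ) (hδ₁ : δ ≤ 1) (hε : δ ≤ ε)
    (hS : 0 ≤ S) (hA : 0 ≤ A) (hσ : |σ i| ≤ K) (hp : g.IsGap p (i, 0))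
    (hG : (g.gap p (i, 0))⁻¹ ≤ G) (hH : g.gap p (i, 0) ≤ H) {x : ℝ}
    (hx : x ∈ Set.Ioo (g.xl i) (g.xr i)) :
    ‖σ i • (f x - m i)‖ ≤ oscillationBound G H g.L S K * (ε * A) := by
  have hε0 : 0 ≤ ε := hδ.le.trans hε
  have hgap := hp.gap_pos
  have hG0 : 0 ≤ G := (inv_nonneg.2 hgap.le).trans hG
  have hH0 : 0 ≤ H := hgap.le.trans hH
  have hK0 : 0 ≤ K := (abs_nonneg _).trans hσ
  have hl := g.len_pos i
  have hL := g.len_le_L i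
  have hL0 : 0 ≤ g.L := hl.le.trans hL
  refine (h.norm_smul_sub_mean_le hδ hp hx).trans ?_
  have e : oscillationBound G H g.L S K * (ε * A) =
      (ε * (2 * G * A) + 1 * (S * (ε * A) * H) + K * (S * (ε * A) * g.L)) * g.L := by
    unfold oscillationBound
    ring
  rw [e, mul_add δ]
  gcongr

end TimeLocalisation

/-! ### Assembly of the proposition. -/

open TimeLocalisation in
theorem mainTheorem6 {N : ℕ} (g : Geometry N) {v₀ vr γ K : ℝ} (hv₀ : 0 < v₀) (hvr : 0 < vr)
    (hγ₀ : 0 < γ) (hγ₁ : γ < 1) :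
    ∃ C : ℝ, ∀ b : Bulk, b.v₀ = v₀ → b.vr = vr → b.δ < 1 →
      ∀ md : Modulation N, md.IsSubwavelength b.δ γ K →
      ∀ α ∈ g.brillouinZone, ∀ (v : ℝ → ℝ → ℂ) (A : ℝ),
        IsLowFrequency v (b.δ ^ ((1 - γ) / 2)) A →
        (∀ x t, waveField v (x + g.L) t
          = Complex.exp (Complex.I * α * g.L) * waveField v x t) →
        IsSolution g b md (waveField v) →
        ∀ i : Fin N,
          Integrable (resonatorAmplitude g v i) ∧
          Differentiable ℝ (resonatorSignal g v i) ∧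
          Differentiable ℝ (fun t => md.invκ i t • deriv (resonatorSignal g v i) t) ∧
          (∀ x ∈ Set.Ioo (g.xl i) (g.xr i), ∀ t,
            ‖(md.s i t)⁻¹ • (waveField v x t - resonatorSignal g v i t)‖
              ≤ C * b.δ ^ (1 - γ) * A) ∧
          ∀ t,
            ‖(∑ j, (md.s j t)⁻¹ • (g.capacitance α i j * resonatorSignal g v j t))
              + (b.ρr * g.len i / (b.δ * b.κr * md.s i t)) •
                deriv (fun τ => ((md.κp i τ)⁻¹ + md.c i * md.f τ) •
                  deriv (resonatorSignal g v i) τ) t‖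
              ≤ C * b.δ ^ (1 - γ) * A := by
  obtain ⟨G, H, hgaps⟩ := g.exists_gap_bounds
  set S := curvatureBound v₀ vr K with hSdef
  set T := oscillationBound G H g.L S K with hTdef
  -- `T` serves the oscillation bound, and each of the two gaps next to a resonator contributes `S *
  -- H + 2 * G * T` to the equation.
  refine ⟨T + 2 * (S * H + 2 * G * T), ?_⟩
  rintro b rfl rfl hδ₁ md hmd α - v A hv hq hu i
  have hη := scale_pos b γ
  have hδ := b.δ_pos
  have hA := hv.A_nonneg
  have hK := Modulation.K_nonneg hmd i
  -- This uses δ < 1 and γ > 0: the O(δ) flux through an interface is absorbed into the order of the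
  -- error.
  have hε : b.δ ≤ b.δ ^ (1 - γ) := by
    simpa using Real.rpow_le_rpow_of_exponent_ge hδ hδ₁.le (by linarith : 1 - γ ≤ 1)
  have hε0 : 0 ≤ b.δ ^ (1 - γ) := hδ.le.trans hε
  have hS : 0 ≤ S := by rw [hSdef, curvatureBound]; positivity
  obtain ⟨p, q, hp, hq', hG, hH, hG', hH'⟩ := hgaps i
  have hG0 : 0 ≤ G := (inv_nonneg.2 hp.gap_pos.le).trans hG
  have hH0 : 0 ≤ H := hp.gap_pos.le.trans hH
  have hT : 0 ≤ T := by
    have := g.L_pos i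
    rw [hTdef, oscillationBound]
    positivity
  have hw := weighted_resonatorAmplitude hv (g := g) i
  have hstat := isQuasistatic_of_isSolution hv₀ hvr hmd hK hv hq hu
  -- Needed for every `j`, since the slopes next to resonator `i` involve its neighbours.
  have hosc : ∀ t j, ∀ x ∈ Set.Ioo (g.xl j) (g.xr j),
      ‖(md.s j t)⁻¹ • (waveField v x t - resonatorSignal g v j t)‖ ≤
        T * (b.δ ^ (1 - γ) * A) := by
    intro t j x hx
    obtain ⟨p', -, hp', -, hGj, hHj, -, -⟩ := hgaps j
    exact (hstat t).norm_smul_sub_mean_le_oscillationBound hδ hδ₁.le hε hS hA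
      (Modulation.abs_inv_s_le hmd j t) hp' hGj hHj hx
  refine ⟨?_, ?_, ?_, fun x hx t => ?_, fun t => ?_⟩
  · simpa using integrable_mul_of_weighted (φ := fun _ => 1) (c := 1) hw continuous_const
      fun ω => by simpa using sq_nonneg (ω / b.δ ^ ((1 - γ) / 2))
  · rw [resonatorSignal_eq_timeMoment]
    exact fun t => (hasDerivAt_timeMoment hη hw (by norm_num) t).differentiableAt
  · rw [resonatorSignal_eq_timeMoment, deriv_timeMoment_zero hη hw]
    intro t
    obtain ⟨r, hr, -⟩ := Modulation.exists_hasDerivAt_invκ hδ hmd i t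
    exact (hasDerivAt_smul_timeMoment hη hw hr).differentiableAt
  · rw [mul_assoc]
    refine (hosc t i x hx).trans (mul_le_mul_of_nonneg_right ?_ (by positivity))
    exact le_add_of_nonneg_right (by positivity)
  · obtain ⟨D₁, I₁, hD₁, hI₁, e₁⟩ := (hstat t).flux_left i
    obtain ⟨D₂, I₂, hD₂, hI₂, e₂⟩ := (hstat t).flux_right i
    -- An exact identity: the flux conditions `e₁`, `e₂` turn the interior derivatives into exterior
    -- ones, and the prefactor cancels δ and vr² = κr / ρr.
    have hdyn : (b.ρr * g.len i / (b.δ * b.κr * md.s i t)) •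
        deriv (fun τ => ((md.κp i τ)⁻¹ + md.c i * md.f τ) • deriv (resonatorSignal g v i) τ) t =
          D₂ - D₁ := by
      have h := len_smul_deriv_modulated_eq hvr hmd hv hu i t hI₁ hI₂
      simp only [Modulation.invκ] at h
      have hρ := b.ρr_pos.ne'
      have hκ := b.κr_pos.ne'
      have hs := md.s_ne_zero i t
      have e : b.ρr * g.len i / (b.δ * b.κr * md.s i t) =
          (b.δ⁻¹ * (md.s i t)⁻¹ * (b.ρr / b.κr)) * g.len i := by
        field_simp
      have e' : b.ρr / b.κr * b.vr ^ 2 = 1 := by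
        rw [b.vr_sq]
        field_simp
      rw [e, mul_smul, h, smul_smul, mul_assoc, e', mul_one, mul_smul, smul_sub, ← e₁, ← e₂,
        ← smul_sub, smul_smul, inv_mul_cancel₀ hδ.ne', one_smul]
    rw [hdyn, Geometry.sum_capacitance hp hq' α (fun j => (md.s j t)⁻¹)
      (fun j => resonatorSignal g v j t)]
    have hl₁ : Set.Ioo (g.right p.1 p.2) (g.left i 0) ∈ 𝓝[<] (g.xl i) := by
      rw [← g.left_zero]
      exact Ioo_mem_nhdsLT hp.lt
    have hl₂ : Set.Ioo (g.right i 0) (g.left q.1 q.2) ∈ 𝓝[>] (g.xr i) := by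
      rw [← g.right_zero]
      exact Ioo_mem_nhdsGT hq'.lt
    have h₁ := (hstat t).norm_limit_sub_slope_le (hosc t) hp hl₁ hD₁
    have h₂ := (hstat t).norm_limit_sub_slope_le (hosc t) hq' hl₂ hD₂
    have hbound : ∀ d : ℝ, d⁻¹ ≤ G → d ≤ H →
        S * (b.δ ^ (1 - γ) * A) * d + 2 * d⁻¹ * (T * (b.δ ^ (1 - γ) * A)) ≤
          (S * H + 2 * G * T) * (b.δ ^ (1 - γ) * A) := by
      intro d hdG hdH
      calc _ ≤ S * (b.δ ^ (1 - γ) * A) * H + 2 * G * (T * (b.δ ^ (1 - γ) * A)) := by gcongr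
        _ = _ := by ring
    have h₃ := h₁.trans (hbound _ hG hH)
    have h₄ := h₂.trans (hbound _ hG' hH')
    refine (le_of_eq (congrArg norm ?_)).trans ((norm_sub_le _ _).trans
      ((add_le_add h₃ h₄).trans ?_))
    · abel
    · have h₅ : 0 ≤ T * (b.δ ^ (1 - γ) * A) := by positivity
      linarith
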